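/- **Conventions.** A normalized Hamiltonian family is a sequence $H=(H_n)_n$ where $H_n$ is a Hermitian operator on $n$ qubits with operator norm $\|H_n\|=1$. A circuit of size $s$ is a product of at most $s$ gates, each an arbitrary unitary acting on at most two qubits; circuits may depend non-uniformly on $n$. All norms of operators are operator norms for the Euclidean norm. Write $T=2^{\Omega(n)}$ if for some $c>0$ we have $T(n)\ge 2^{cn}$ for all large $n$; $\delta E=2^{-\Omega(n)}$ if for some $c>0$ we have $\delta E(n)\le 2^{-cn}$ for all large $n$; and $\alpha=1/\mathrm{poly}(n)$ if $\alpha(n)\ge 1/p(n)$ for all large $n$, for some non-zero polynomial $p$ with coefficients in $\mathbb{N}$. **Fast forwarding.** For $T,\alpha:\mathbb{N}\to\mathbb{R}$, the family $H$ is *$(T,\alpha)$-fast-forwarded* if there is a polynomial $p$ such that for all large $n$ and all real $t$ with $0\le t\le T(n)$ there are a number $c\le p(n)$ of ancilla qubits and a circuit $\widetilde U$ of size at most $p(n)$ on $n+c$ qubits such that for every unit vector $|\psi\rangle$ of the $n$ qubits $$\bigl\|(e^{-iH_nt}\otimes 1-\widetilde U)\,|\psi\rangle\otimes|0\rangle\bigr\|\le\alpha(n).$$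 **Energy measurement.** For $\eta,\delta E,\beta:\mathbb{N}\to\mathbb{R}$, the family $H$ is *$(\eta,\delta E,\beta)$-SEEM* if there is a polynomial $p$ such that for all large $n$ there are an output register and a work register with together at most $p(n)$ qubits, and unitaries $U,\widetilde U$ on the $n$ qubits together with these registers, such that 1. for every unit eigenvector $|\psi_E\rangle$ of $H_n$ with eigenvalue $E$ there are complex numbers $a_{E'}$ and unit vectors $|g(E')\rangle$ of the work register with $$U|\psi_E,0,0\rangle=|\psi_E\rangle\sum_{E'}a_{E'}|E',g(E')\rangle ,\qquad \sum_{E':\,|E-E'|\le\delta E(n)}|a_{E'}|^2\ge\eta(n),$$ where $E'$ runs over the values of the output register, whose basis states are read as signed binary fixed-point numbers (two's complement, with a fixed number of digits after the point that may depend on $n$); 2. $\widetilde U$ is a circuit of size at most $p(n)$, and $\|U-\widetilde U\|\le\beta(n)$. **Theorem.** Let $\mathsf{FF}_{exp}$ be the class of normalized Hamiltonian families $H$ for which there is $T=2^{\Omega(n)}$ such that $H$ is $(T,\alpha)$-fast-forwarded for every $\alpha=1/\mathrm{poly}(n)$. Let $\mathsf{SEEM}_{exp}$ be the class of normalized Hamiltonian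 families $H$ for which there is $\delta E=2^{-\Omega(n)}$ such that $H$ is $(\eta,\delta E,\beta)$-SEEM for all $\eta,\beta$ with $1-\eta=1/\mathrm{poly}(n)$ and $\beta=1/\mathrm{poly}(n)$. Then $$\mathsf{FF}_{exp}=\mathsf{SEEM}_{exp}.$$ -/

import Mathlib

open scoped Matrix Matrix.Norms.L2Operator

namespace FastForward

/-! Registers of qubits are indexed by finite types `Q`; the computational basis of a register
is `Q → Bool`. Two registers `P`, `Q` are joined to the register `P ⊕ Q`. The norm `‖A‖` of a
matrix is always the operator norm with respect to the Euclidean norm of vectors. -/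

/-- Vectors of the Hilbert space of a register (not necessarily normalized). -/
abbrev Ket (Q : Type) : Type := (Q → Bool) → ℂ

/-- Linear operators on the Hilbert space of a register, in the computational basis. -/
abbrev Op (Q : Type) : Type := Matrix (Q → Bool) (Q → Bool) ℂ

/-- The Euclidean (Hilbert space) norm of a vector. -/
noncomputable def ketNorm {Q : Type} [Fintype Q] [DecidableEq Q] (v : Ket Q) : ℝ :=
  ‖(WithLp.toLp 2 v : EuclideanSpace ℂ (Q → Bool))‖

/-- The computational basis vector `|x⟩`. -/
def ket {Q : Type} [Fintype Q] [DecidableEq Q] (x : Q → Bool) : Ket Q := Pi.single x 1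

/-- The basis vector `|0⋯0⟩`. -/
def ketZero (Q : Type) [Fintype Q] [DecidableEq Q] : Ket Q := ket fun _ => false

/-- The tensor product `v ⊗ w` of vectors. -/
def tensorKet {P Q : Type} (v : Ket P) (w : Ket Q) : Ket (P ⊕ Q) :=
  fun x => v (fun p => x (Sum.inl p)) * w (fun q => x (Sum.inr q))

/-- The tensor product `A ⊗ B` of operators. -/
def tensorOp {P Q : Type} (A : Op P) (B : Op Q) : Op (P ⊕ Q) :=
  fun x y => A (fun p => x (Sum.inl p)) (fun p => y (Sum.inl p)) *
    B (fun q => x (Sum.inr q)) (fun q => y (Sum.inr q))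

/-- The operator on the whole register which applies `u` to the qubits in `S` and the identity
to all the other qubits. -/
def embedOp {Q : Type} [Fintype Q] [DecidableEq Q] (S : Finset Q) (u : Op S) : Op Q :=
  fun x y => if ∀ q, q ∉ S → x q = y q then u (fun q => x q) (fun q => y q) else 0

/-- A quantum gate: an arbitrary unitary applied to at most two qubits. -/
def IsGate {Q : Type} [Fintype Q] [DecidableEq Q] (G : Op Q) : Prop :=
  ∃ S : Finset Q, S.card ≤ 2 ∧
    ∃ u : Op S, u ∈ Matrix.unitaryGroup (S → Bool) ℂ ∧ G = embedOp S u

/-- `U` is computed exactly by a quantum circuit with at most `s` one- and two-qubit gates.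
(Such an operator is unitary.) -/
def HasCircuit {Q : Type} [Fintype Q] [DecidableEq Q] (U : Op Q) (s : ℕ) : Prop :=
  ∃ gates : List (Op Q), gates.length ≤ s ∧ (∀ G ∈ gates, IsGate G) ∧ gates.prod = U

/-- A family `(H_n)` of normalized Hamiltonians, `H_n` acting on `n` qubits. -/
structure HamiltonianFamily where
  /-- The Hamiltonian on `n` qubits. -/
  op : ∀ n : ℕ, Op (Fin n)
  isHermitian : ∀ n, (op n).IsHermitian
  norm_eq_one : ∀ n, ‖op n‖ = 1

/-- The time evolution `e^{-iHt}`. -/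
noncomputable def evolution {n : ℕ} (H : Op (Fin n)) (t : ℝ) : Op (Fin n) :=
  NormedSpace.exp ((-(Complex.I * (t : ℂ))) • H)

/-- The family `H` can be `(T, α)`-fast forwarded. The bound `p` on the number of gates and on
the number `c` of ancilla qubits is the same for all times `t ≤ T n`. As usual for families,
the bounds are asymptotic in `n`. -/
def IsFF (H : HamiltonianFamily) (T α : ℕ → ℝ) : Prop :=
  ∃ p : Polynomial ℕ, ∀ᶠ n in Filter.atTop, ∀ t : ℝ, 0 ≤ t → t ≤ T n →
    ∃ c : ℕ, c ≤ p.eval n ∧ ∃ U' : Op (Fin n ⊕ Fin c), HasCircuit U' (p.eval n) ∧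
      ∀ ψ : Ket (Fin n), ketNorm ψ = 1 →
        ketNorm ((tensorOp (evolution (H.op n) t) 1 - U') *ᵥ tensorKet ψ (ketZero (Fin c)))
          ≤ α n

/-- The number `E'` that an output register of `m + 1` qubits in the basis state `|x⟩` denotes:
signed binary fixed-point notation (two's complement, sign bit last) with `f` binary digits
after the point. -/
noncomputable def outcome {m : ℕ} (f : ℕ) (x : Fin (m + 1) → Bool) : ℝ :=
  ((∑ j : Fin m, if x j.castSucc then (2 : ℝ) ^ (j : ℕ) else 0)
    - (if x (Fin.last m) then (2 : ℝ) ^ m else 0)) / 2 ^ f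

open Classical in
/-- `U`, acting on the system, on an output register (read with `f` digits after the point) and
on a work register, is a premeasurement of the energy of `H` with accuracy `δ` and confidence
`η` which does not perturb eigenvectors of `H`: for every normalized eigenvector `ψ` with
eigenvalue `E`, `U |ψ,0,0⟩ = |ψ⟩ ∑_x a_x |x, g_x⟩` with normalized garbage states `g_x`, and the
outcome `E'` denoted by `x` satisfies `Pr(|E - E'| ≤ δ) ≥ η`. -/
def IsPremeasurement {n m w : ℕ} (H : Op (Fin n)) (f : ℕ)
    (U : Op (Fin n ⊕ (Fin (m + 1) ⊕ Fin w))) (η δ : ℝ) : Prop :=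
  ∀ (ψ : Ket (Fin n)) (E : ℝ), ketNorm ψ = 1 → H *ᵥ ψ = (E : ℂ) • ψ →
    ∃ (a : (Fin (m + 1) → Bool) → ℂ) (g : (Fin (m + 1) → Bool) → Ket (Fin w)),
      (∀ x, ketNorm (g x) = 1) ∧
      U *ᵥ tensorKet ψ (tensorKet (ketZero (Fin (m + 1))) (ketZero (Fin w))) =
        tensorKet ψ (∑ x, a x • tensorKet (ket x) (g x)) ∧
      η ≤ ∑ x with |E - outcome f x| ≤ δ, ‖a x‖ ^ 2

/-- The family `H` is `(η, δE, β)`-SEEM (super-efficient energy measurable). As usual for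
families, the bounds are asymptotic in `n`. -/
def IsSEEM (H : HamiltonianFamily) (η δE β : ℕ → ℝ) : Prop :=
  ∃ p : Polynomial ℕ, ∀ᶠ n in Filter.atTop, ∃ m w f : ℕ, m + 1 + w ≤ p.eval n ∧
    ∃ U U' : Op (Fin n ⊕ (Fin (m + 1) ⊕ Fin w)),
      U ∈ Matrix.unitaryGroup (Fin n ⊕ (Fin (m + 1) ⊕ Fin w) → Bool) ℂ ∧
      IsPremeasurement (H.op n) f U (η n) (δE n) ∧
      HasCircuit U' (p.eval n) ∧
      ‖U - U'‖ ≤ β n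

/-- `T = 2^{Ω(n)}`. -/
def IsExpLarge (T : ℕ → ℝ) : Prop :=
  ∃ c : ℝ, 0 < c ∧ ∀ᶠ n : ℕ in Filter.atTop, (2 : ℝ) ^ (c * n) ≤ T n

/-- `δ = 2^{-Ω(n)}`. -/
def IsExpSmall (δ : ℕ → ℝ) : Prop :=
  ∃ c : ℝ, 0 < c ∧ ∀ᶠ n : ℕ in Filter.atTop, δ n ≤ (2 : ℝ) ^ (-(c * n))

/-- `α = 1 / poly(n)`, that is, `α` is bounded below by the inverse of a polynomial. -/
def IsInvPoly (α : ℕ → ℝ) : Prop :=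
  ∃ p : Polynomial ℕ, p ≠ 0 ∧ ∀ᶠ n : ℕ in Filter.atTop, 1 / ((p.eval n : ℕ) : ℝ) ≤ α n

/-- The class of exponentially fast-forwardable normalized Hamiltonians. -/
def FFexp : Set HamiltonianFamily :=
  {H | ∃ T : ℕ → ℝ, IsExpLarge T ∧ ∀ α : ℕ → ℝ, IsInvPoly α → IsFF H T α}

/-- The class of normalized Hamiltonians with exponentially accurate efficient energy
measurements; both the failure probability `1 - η` and the demolition parameter `β` may be
prescribed to be any inverse polynomial. -/
def SEEMexp : Set HamiltonianFamily :=
  {H | ∃ δE : ℕ → ℝ, IsExpSmall δE ∧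
    ∀ η β : ℕ → ℝ, IsInvPoly (fun n => 1 - η n) → IsInvPoly β → IsSEEM H η δE β}

end FastForward

/-!
Both inclusions rest on one duality: the evolution `e^{-iHt}` writes the energy into a phase, and a
measurement writes it into a register.

*From fast forwarding to measurement.* Phase estimation with `m + 1 ≈ cn` output qubits needs the
evolutions for the times `2^j π / 2 ≤ 2^{cn}`, each controlled by one output qubit, and a quantum
Fourier transform. A circuit can be controlled gate by gate: a two-qubit gate is diagonalized, and a
controlled diagonal gate splits into phases on two qubits because `2XY = X + Y - (X ⊕ Y)`
(`HasCircuit.ctrlOp_liftOp`). The Fourier transform is built stage by stage, where its matrix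
coefficients are products over the input bits (`fourierStages`, `hasCircuit_fourierStages`). On an
eigenvector of energy `E` the amplitude of an outcome `E'` is a geometric series of size
`O(2^{-m} / |E - E'|)` (`norm_estimateAmplitude_le`), so that for the coarser accuracy `2^{-cn/3}` a
union bound over all outcomes gives an exponentially small probability of failure.

The fast-forwarding circuits are only accurate when their work qubits start in the state `|0⟩`,
whereas a measurement circuit has to be close in operator norm to an exact premeasurement. The
premeasurement is therefore obtained from the circuit itself, by correcting it on the subspace where
output and work qubits are `|0⟩`. A polar decomposition provides a correction that is a unitary
close to the identity (`exists_unitary_eq_on_projection`, `exists_premeasurement`).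

*From measurement to fast forwarding.* If `U` measures the energy, then `U† e^{-iE't} U`, with the
phase read off the output register, approximates `e^{-iHt}`. An eigenvector incurs an error of at
most `δE t` from outcomes `E'` that are within `δE` of the energy, and at most `2` from the others.
Errors on distinct eigenvectors are orthogonal as `U` leaves eigenvectors of `H` in place, so the
bound holds for all states (`ketNorm_evolution_sub_le`, `exists_fastForward`). For `δE ≤ 2^{-cn}` the
error is negligible up to the time `2^{cn/2}`.
-/

open scoped Matrix Matrix.Norms.L2Operator

set_option linter.unusedSectionVars false

namespace FastForward

/-! ### The Euclidean norm of vectors and the operator norm -/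

section Norm

variable {Q : Type} [Fintype Q] [DecidableEq Q]

theorem ketNorm_sq (v : Ket Q) : ketNorm v ^ 2 = ∑ x, ‖v x‖ ^ 2 := by
  simp [ketNorm, EuclideanSpace.norm_sq_eq]

theorem ketNorm_nonneg (v : Ket Q) : 0 ≤ ketNorm v := norm_nonneg _

theorem ketNorm_add_le (v w : Ket Q) : ketNorm (v + w) ≤ ketNorm v + ketNorm w := by
  simpa [ketNorm] using
    norm_add_le (WithLp.toLp 2 v : EuclideanSpace ℂ (Q → Bool)) (WithLp.toLp 2 w)

theorem ketNorm_smul (c : ℂ) (v : Ket Q) : ketNorm (c • v) = ‖c‖ * ketNorm v := by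
  simpa [ketNorm] using norm_smul c (WithLp.toLp 2 v : EuclideanSpace ℂ (Q → Bool))

theorem ketNorm_zero : ketNorm (0 : Ket Q) = 0 := by simp [ketNorm]

theorem ketNorm_eq_zero {v : Ket Q} : ketNorm v = 0 ↔ v = 0 := by simp [ketNorm]

theorem ketNorm_mulVec_le (A : Op Q) (v : Ket Q) : ketNorm (A *ᵥ v) ≤ ‖A‖ * ketNorm v :=
  Matrix.l2_opNorm_mulVec A (WithLp.toLp 2 v)

theorem norm_le_of_ketNorm_mulVec_le {A : Op Q} {c : ℝ} (hc : 0 ≤ c)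
    (h : ∀ v, ketNorm (A *ᵥ v) ≤ c * ketNorm v) : ‖A‖ ≤ c := by
  rw [Matrix.cstar_norm_def]
  exact ContinuousLinearMap.opNorm_le_bound _ hc fun v => h (WithLp.ofLp v)

theorem ketNorm_le_of_sq_le {P : Type} [Fintype P] [DecidableEq P] {v : Ket Q} {w : Ket P} {c : ℝ}
    (hc : 0 ≤ c) (h : ∑ x, ‖v x‖ ^ 2 ≤ c ^ 2 * ∑ x, ‖w x‖ ^ 2) : ketNorm v ≤ c * ketNorm w := by
  rw [← ketNorm_sq, ← ketNorm_sq, ← mul_pow] at h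
  exact le_of_sq_le_sq h (mul_nonneg hc (ketNorm_nonneg w))

theorem norm_of_unitary_le {A : Op Q} (hA : A ∈ Matrix.unitaryGroup (Q → Bool) ℂ) : ‖A‖ ≤ 1 :=
  (CStarRing.norm_of_mem_unitary hA).le

theorem ketNorm_unitary_mulVec {A : Op Q} (hA : A ∈ Matrix.unitaryGroup (Q → Bool) ℂ) (v : Ket Q) :
    ketNorm (A *ᵥ v) = ketNorm v := by
  have key : ∀ B ∈ Matrix.unitaryGroup (Q → Bool) ℂ, ∀ w, ketNorm (B *ᵥ w) ≤ ketNorm w :=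
    fun B hB w => (ketNorm_mulVec_le B w).trans
      (mul_le_of_le_one_left (ketNorm_nonneg w) (norm_of_unitary_le hB))
  refine le_antisymm (key A hA v) ?_
  have h := key (star A) (Unitary.star_mem hA) (A *ᵥ v)
  rwa [Matrix.mulVec_mulVec, Unitary.star_mul_self_of_mem hA, Matrix.one_mulVec] at h

end Norm

/-! ### Operators acting on part of a register -/

section Lift

variable {K P Q : Type} [Fintype K] [DecidableEq K] [Fintype P] [DecidableEq P]
  [Fintype Q] [DecidableEq Q]

/-- The operator on the register `Q` that applies `A` to the qubits `f p`, the qubit `f p` in the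
role of the qubit `p` of the register `P`, and the identity to the qubits outside the range of
`f`. The map `f` is meant to be injective. -/
def liftOp (f : P → Q) (A : Op P) : Op Q :=
  fun x y => if ∀ q, (∀ p, f p ≠ q) → x q = y q then A (x ∘ f) (y ∘ f) else 0

theorem extend_eq_of_forall_ne {f : P → Q} {p : P → Bool} {x : Q → Bool} {q : Q}
    (h : ∀ i, f i ≠ q) : Function.extend f p x q = x q :=
  Function.extend_apply' _ _ _ (by simpa using h)

theorem extend_comp_eq {f : P → Q} (hf : f.Injective) (p : P → Bool) (x : Q → Bool) :
    Function.extend f p x ∘ f = p :=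
  funext fun i => hf.extend_apply _ _ i

theorem extend_comp_of_agree {f : P → Q} (hf : f.Injective) {x y : Q → Bool}
    (h : ∀ q, (∀ p, f p ≠ q) → x q = y q) : Function.extend f (y ∘ f) x = y := by
  funext q
  by_cases hq : ∃ p, f p = q
  · obtain ⟨p, rfl⟩ := hq
    exact hf.extend_apply _ _ p
  · push Not at hq
    rw [extend_eq_of_forall_ne hq, h q hq]

/-- `Function.extend f p x` is the basis state `x` with the qubits in the range of `f` replaced by
`p`. -/
theorem liftOp_mulVec {f : P → Q} (hf : f.Injective) (A : Op P) (v : Ket Q) (x : Q → Bool) :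
    (liftOp f A *ᵥ v) x = ∑ p, A (x ∘ f) p * v (Function.extend f p x) := by
  simp only [Matrix.mulVec, dotProduct, liftOp, ite_mul, zero_mul]
  rw [← Finset.sum_filter]
  refine Finset.sum_nbij' (fun y => y ∘ f) (fun p => Function.extend f p x) (by simp) ?_ ?_ ?_ ?_
  · intro p _
    simp only [Finset.mem_filter, Finset.mem_univ, true_and]
    exact fun q hq => (extend_eq_of_forall_ne hq).symm
  · intro y hy
    exact extend_comp_of_agree hf (by simpa using hy)
  · intro p _
    exact extend_comp_eq hf p x
  · intro y hy
    rw [extend_comp_of_agree hf (by simpa using hy)]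

theorem liftOp_mul_apply {f : P → Q} (hf : f.Injective) (A : Op P) (B : Op Q) (x z : Q → Bool) :
    (liftOp f A * B) x z = ∑ p, A (x ∘ f) p * B (Function.extend f p x) z :=
  liftOp_mulVec hf A (fun y => B y z) x

theorem liftOp_mul {f : P → Q} (hf : f.Injective) (A B : Op P) :
    liftOp f (A * B) = liftOp f A * liftOp f B := by
  ext x z
  rw [liftOp_mul_apply hf]
  have hagree : ∀ p, (∀ q, (∀ i, f i ≠ q) → Function.extend f p x q = z q) ↔
      ∀ q, (∀ i, f i ≠ q) → x q = z q := fun p =>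
    forall₂_congr fun q hq => by rw [extend_eq_of_forall_ne hq]
  by_cases h : ∀ q, (∀ i, f i ≠ q) → x q = z q
  · simp only [liftOp, hagree, if_pos h, extend_comp_eq hf, Matrix.mul_apply]
  · simp only [liftOp, hagree, if_neg h, mul_zero, Finset.sum_const_zero]

theorem liftOp_one {f : P → Q} : liftOp f (1 : Op P) = 1 := by
  ext x y
  simp only [liftOp, Matrix.one_apply]
  by_cases hxy : x = y
  · simp [hxy]
  · rw [if_neg hxy]
    split_ifs with h1 h2
    · refine absurd (funext fun q => ?_) hxy
      by_cases hq : ∃ p, f p = q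
      · obtain ⟨p, rfl⟩ := hq
        exact congrFun h2 p
      · push Not at hq
        exact h1 q hq
    · rfl
    · rfl

theorem liftOp_sub (f : P → Q) (A B : Op P) : liftOp f (A - B) = liftOp f A - liftOp f B := by
  ext x y
  simp only [liftOp, Matrix.sub_apply]
  split_ifs <;> simp

theorem liftOp_star (f : P → Q) (A : Op P) : liftOp f (star A) = star (liftOp f A) := by
  ext x y
  simp only [liftOp, Matrix.star_apply, apply_ite star, star_zero, eq_comm]

theorem liftOp_mem_unitary {f : P → Q} (hf : f.Injective) {A : Op P}
    (hA : A ∈ Matrix.unitaryGroup (P → Bool) ℂ) :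
    liftOp f A ∈ Matrix.unitaryGroup (Q → Bool) ℂ := by
  rw [Matrix.mem_unitaryGroup_iff, ← liftOp_star, ← liftOp_mul hf,
    Matrix.mem_unitaryGroup_iff.1 hA, liftOp_one]

theorem liftOp_liftOp {g : P → Q} {f : K → P} (hg : g.Injective) (A : Op K) :
    liftOp g (liftOp f A) = liftOp (g ∘ f) A := by
  ext x y
  have hiff : ((∀ q, (∀ p, g p ≠ q) → x q = y q) ∧
      ∀ p, (∀ k, f k ≠ p) → (x ∘ g) p = (y ∘ g) p) ↔
      ∀ q, (∀ k, (g ∘ f) k ≠ q) → x q = y q := by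
    constructor
    · rintro ⟨h1, h2⟩ q hq
      by_cases hq' : ∃ p, g p = q
      · obtain ⟨p, rfl⟩ := hq'
        exact h2 p fun k hk => hq k (by simp [hk])
      · push Not at hq'
        exact h1 q hq'
    · intro h
      exact ⟨fun q hq => h q fun k => hq (f k), fun p hp => h (g p) fun k hk => hp k (hg hk)⟩
  simp only [liftOp, ← hiff, ite_and]
  rfl

theorem liftOp_diagonal {f : P → Q} (φ : (P → Bool) → ℂ) :
    liftOp f (Matrix.diagonal φ) = Matrix.diagonal fun x => φ (x ∘ f) := by
  ext x y
  by_cases hxy : x = y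
  · subst hxy
    simp [liftOp]
  · rw [Matrix.diagonal_apply_ne _ hxy]
    simp only [liftOp]
    split_ifs with h
    · refine Matrix.diagonal_apply_ne _ fun h' => hxy (funext fun q => ?_)
      by_cases hq : ∃ p, f p = q
      · obtain ⟨p, rfl⟩ := hq
        exact congrFun h' p
      · push Not at hq
        exact h q hq
    · rfl

/-- A sum over the basis states of `Q` is a sum over the assignments `r` to the qubits outside the
range of `f` (extended by `false`) and over the basis states of `P`. -/
theorem sum_eq_sum_slices {M : Type*} [AddCommMonoid M] {f : P → Q} (hf : f.Injective)
    (g : (Q → Bool) → M) :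
    ∑ x, g x = ∑ r with r ∘ f = (fun _ => false), ∑ p, g (Function.extend f p r) := by
  rw [← Finset.sum_product']
  refine Finset.sum_nbij' (fun x => (Function.extend f (fun _ => false) x, x ∘ f))
    (fun rp => Function.extend f rp.2 rp.1) ?_ (by simp) ?_ ?_ ?_
  · intro x _
    simp [extend_comp_eq hf]
  · intro x _
    exact extend_comp_of_agree hf fun q hq => by simp [extend_eq_of_forall_ne hq]
  · rintro ⟨r, p⟩ h
    simp only [Finset.mem_product, Finset.mem_filter, Finset.mem_univ, true_and, and_true] at h
    refine Prod.ext ?_ (extend_comp_eq hf p r)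
    simp only
    rw [← h]
    exact extend_comp_of_agree hf fun q hq => extend_eq_of_forall_ne hq
  · intro x _
    simp only
    congr 1
    exact (extend_comp_of_agree hf fun q hq => by simp [extend_eq_of_forall_ne hq]).symm

theorem extend_extend {f : P → Q} (hf : f.Injective) (p p' : P → Bool) (r : Q → Bool) :
    Function.extend f p (Function.extend f p' r) = Function.extend f p r := by
  funext q
  by_cases hq : ∃ i, f i = q
  · obtain ⟨i, rfl⟩ := hq
    simp [hf.extend_apply]
  · push Not at hq
    simp [extend_eq_of_forall_ne hq]

/-- If `A` satisfies a norm bound on each of the slices of `v` obtained by fixing the qubits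
outside the range of `f`, then `liftOp f A` satisfies it on `v`. -/
theorem ketNorm_liftOp_mulVec_le {f : P → Q} (hf : f.Injective) {A : Op P} {v : Ket Q} {c : ℝ}
    (hc : 0 ≤ c) (h : ∀ r : Q → Bool,
      ketNorm (A *ᵥ fun p => v (Function.extend f p r)) ≤
        c * ketNorm fun p => v (Function.extend f p r)) :
    ketNorm (liftOp f A *ᵥ v) ≤ c * ketNorm v := by
  refine ketNorm_le_of_sq_le hc ?_
  rw [sum_eq_sum_slices hf, sum_eq_sum_slices hf, Finset.mul_sum]
  refine Finset.sum_le_sum fun r _ => ?_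
  have hr := pow_le_pow_left₀ (ketNorm_nonneg _) (h r) 2
  rw [mul_pow, ketNorm_sq, ketNorm_sq] at hr
  refine le_of_eq_of_le (Finset.sum_congr rfl fun p _ => ?_) hr
  rw [liftOp_mulVec hf, extend_comp_eq hf]
  simp only [extend_extend hf]
  rfl

theorem embedOp_eq_liftOp (S : Finset Q) (u : Op S) :
    embedOp S u = liftOp (Subtype.val : S → Q) u := by
  ext x y
  have : (∀ q, q ∉ S → x q = y q) ↔ ∀ q, (∀ p : S, (p : Q) ≠ q) → x q = y q :=
    forall_congr' fun q => by
      have : q ∉ S ↔ ∀ p : S, (p : Q) ≠ q :=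
        ⟨fun h p hp => h (hp ▸ p.2), fun h hq => h ⟨q, hq⟩ rfl⟩
      rw [this]
  simp only [embedOp, liftOp, this]
  rfl

end Lift

/-! ### Gates and circuits -/

section Circuit

variable {K P Q : Type} [Fintype K] [DecidableEq K] [Fintype P] [DecidableEq P]
  [Fintype Q] [DecidableEq Q]

/-- Gates may be specified by a unitary on any register of at most two qubits, in place of a set of
qubits. -/
theorem isGate_liftOp {f : K → Q} (hf : f.Injective) (hK : Fintype.card K ≤ 2) {u : Op K}
    (hu : u ∈ Matrix.unitaryGroup (K → Bool) ℂ) : IsGate (liftOp f u) := by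
  classical
  refine ⟨Finset.univ.image f, Finset.card_image_le.trans (by simpa using hK),
    liftOp (fun k => ⟨f k, Finset.mem_image_of_mem f (Finset.mem_univ k)⟩) u,
    liftOp_mem_unitary (fun a b h => hf (congrArg Subtype.val h)) hu, ?_⟩
  rw [embedOp_eq_liftOp, liftOp_liftOp Subtype.val_injective]
  rfl

theorem IsGate.exists_liftOp {G : Op Q} (hG : IsGate G) : ∃ S : Finset Q, S.card ≤ 2 ∧
    ∃ u ∈ Matrix.unitaryGroup (S → Bool) ℂ, G = liftOp (Subtype.val : S → Q) u := by
  obtain ⟨S, hS, u, hu, rfl⟩ := hG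
  exact ⟨S, hS, u, hu, embedOp_eq_liftOp S u⟩

theorem IsGate.liftOp {f : P → Q} (hf : f.Injective) {G : Op P} (hG : IsGate G) :
    IsGate (liftOp f G) := by
  obtain ⟨S, hS, u, hu, rfl⟩ := hG.exists_liftOp
  rw [liftOp_liftOp hf]
  exact isGate_liftOp (hf.comp Subtype.val_injective) (by simpa using hS) hu

theorem IsGate.mem_unitary {G : Op Q} (hG : IsGate G) : G ∈ Matrix.unitaryGroup (Q → Bool) ℂ := by
  obtain ⟨S, hS, u, hu, rfl⟩ := hG.exists_liftOp
  exact liftOp_mem_unitary Subtype.val_injective hu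

theorem IsGate.star {G : Op Q} (hG : IsGate G) : IsGate (star G) := by
  obtain ⟨S, hS, u, hu, rfl⟩ := hG.exists_liftOp
  rw [← liftOp_star]
  exact isGate_liftOp Subtype.val_injective (by simpa using hS) (Unitary.star_mem hu)

theorem IsGate.hasCircuit {G : Op Q} (hG : IsGate G) : HasCircuit G 1 :=
  ⟨[G], by simp, by simpa using hG, by simp⟩

theorem HasCircuit.one : HasCircuit (1 : Op Q) 0 := ⟨[], by simp, by simp, by simp⟩

theorem HasCircuit.mono {U : Op Q} {s t : ℕ} (h : HasCircuit U s) (hst : s ≤ t) :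
    HasCircuit U t := by
  obtain ⟨l, hl, h⟩ := h
  exact ⟨l, hl.trans hst, h⟩

theorem HasCircuit.mul {U V : Op Q} {s t : ℕ} (hU : HasCircuit U s) (hV : HasCircuit V t) :
    HasCircuit (U * V) (s + t) := by
  obtain ⟨l, hl, hlg, rfl⟩ := hU
  obtain ⟨l', hl', hlg', rfl⟩ := hV
  refine ⟨l ++ l', by simpa using add_le_add hl hl', fun G hG => ?_, by simp⟩
  rcases List.mem_append.1 hG with h | h
  exacts [hlg G h, hlg' G h]

/-- A multiplicative map that sends gates to circuits of size `r` sends circuits of size `s` to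
circuits of size `r s`. Multiplicativity is only needed for a gate on the left. -/
theorem HasCircuit.of_forall_isGate {Φ : Op P → Op Q} {r : ℕ} (h1 : Φ 1 = 1)
    (hmul : ∀ G B, IsGate G → Φ (G * B) = Φ G * Φ B) (hΦ : ∀ G, IsGate G → HasCircuit (Φ G) r)
    {U : Op P} {s : ℕ} (hU : HasCircuit U s) : HasCircuit (Φ U) (r * s) := by
  obtain ⟨l, hl, hlg, rfl⟩ := hU
  refine HasCircuit.mono ?_ (Nat.mul_le_mul_left r hl)
  clear hl
  induction l with
  | nil => simpa [h1] using HasCircuit.one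
  | cons G l ih =>
    have hG := hlg G (by simp)
    rw [List.prod_cons, hmul _ _ hG, List.length_cons, mul_add, mul_one, add_comm]
    exact (hΦ G hG).mul (ih fun G' h' => hlg G' (by simp [h']))

theorem HasCircuit.liftOp {f : P → Q} (hf : f.Injective) {U : Op P} {s : ℕ}
    (hU : HasCircuit U s) : HasCircuit (liftOp f U) s := by
  simpa using HasCircuit.of_forall_isGate (Φ := FastForward.liftOp f) (r := 1) liftOp_one
    (fun G B _ => liftOp_mul hf G B) (fun G hG => (hG.liftOp hf).hasCircuit) hU

theorem HasCircuit.star {U : Op Q} {s : ℕ} (hU : HasCircuit U s) : HasCircuit (star U) s := by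
  obtain ⟨l, hl, hlg, rfl⟩ := hU
  refine ⟨(l.map Star.star).reverse, by simpa using hl, fun G hG => ?_, ?_⟩
  · simp only [List.mem_reverse, List.mem_map] at hG
    obtain ⟨G', hG', rfl⟩ := hG
    exact (hlg G' hG').star
  · clear hl hlg
    induction l with
    | nil => simp
    | cons G l ih => simp [ih]

theorem HasCircuit.mem_unitary {U : Op Q} {s : ℕ} (hU : HasCircuit U s) :
    U ∈ Matrix.unitaryGroup (Q → Bool) ℂ := by
  obtain ⟨l, -, hlg, rfl⟩ := hU
  exact Submonoid.list_prod_mem _ fun G hG => (hlg G hG).mem_unitary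

/-- A diagonal operator with phases on the diagonal that depend on at most two qubits is a
gate. -/
theorem isGate_diagonal {φ : (Q → Bool) → ℂ} (hφ : ∀ x, ‖φ x‖ = 1) (S : Finset Q)
    (hS : S.card ≤ 2) (hdep : ∀ x y, (∀ q ∈ S, x q = y q) → φ x = φ y) :
    IsGate (Matrix.diagonal φ) := by
  have hext : Matrix.diagonal φ = liftOp (Subtype.val : S → Q) (Matrix.diagonal fun s =>
      φ (Function.extend Subtype.val s fun _ => false)) := by
    rw [liftOp_diagonal]
    congr 1
    funext x
    refine hdep _ _ fun q hq => ?_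
    exact (Subtype.val_injective.extend_apply (x ∘ Subtype.val) (fun _ => false)
      (⟨q, hq⟩ : S)).symm
  rw [hext]
  refine isGate_liftOp Subtype.val_injective (by simpa using hS) ?_
  rw [Matrix.mem_unitaryGroup_iff, Matrix.star_eq_conjTranspose, Matrix.diagonal_conjTranspose,
    Matrix.diagonal_mul_diagonal, ← Matrix.diagonal_one]
  congr 1
  funext s
  simp [← starRingEnd_apply, Complex.mul_conj', hφ]

theorem hasCircuit_diagonal_prod {ι : Type*} (s : Finset ι) (φ : ι → (Q → Bool) → ℂ)
    (h : ∀ i ∈ s, IsGate (Matrix.diagonal (φ i))) :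
    HasCircuit (Matrix.diagonal fun x => ∏ i ∈ s, φ i x) s.card := by
  classical
  induction s using Finset.induction_on with
  | empty => simpa using HasCircuit.one
  | insert a s ha ih =>
    simp only [Finset.prod_insert ha, Finset.card_insert_of_notMem ha]
    rw [← Matrix.diagonal_mul_diagonal, add_comm]
    exact (h a (by simp)).hasCircuit.mul (ih fun i hi => h i (by simp [hi]))

end Circuit

/-! ### Controlled circuits -/

section Control

variable {K P Q : Type} [Fintype K] [DecidableEq K] [Fintype P] [DecidableEq P]
  [Fintype Q] [DecidableEq Q]

/-- The operator `A` controlled by the qubit `q`: it applies `A` when `q` is in the state `|1⟩`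
and the identity when it is in the state `|0⟩`. The operator `A` is meant to act trivially on
`q`. -/
def ctrlOp (q : Q) (A : Op Q) : Op Q :=
  fun x y => if x q then A x y else (1 : Op Q) x y

theorem ctrlOp_mulVec (q : Q) (A : Op Q) (v : Ket Q) (x : Q → Bool) :
    (ctrlOp q A *ᵥ v) x = if x q then (A *ᵥ v) x else v x := by
  by_cases h : x q
  · simp [Matrix.mulVec, ctrlOp, h]
  · simp only [Matrix.mulVec, ctrlOp, h, Bool.false_eq_true, if_false]
    exact congrFun (Matrix.one_mulVec v) x

theorem ctrlOp_mul_apply (q : Q) (A B : Op Q) (x z : Q → Bool) :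
    (ctrlOp q A * B) x z = if x q then (A * B) x z else B x z :=
  ctrlOp_mulVec q A (fun y => B y z) x

theorem ctrlOp_one (q : Q) : ctrlOp q (1 : Op Q) = 1 := by
  ext x y
  simp [ctrlOp]

theorem liftOp_apply_eq_zero {f : P → Q} {q : Q} (hq : ∀ p, f p ≠ q) (A : Op P) {x y : Q → Bool}
    (h : x q ≠ y q) : liftOp f A x y = 0 :=
  if_neg fun h' => h (h' q hq)

/-- The hypothesis says that `A` preserves the state of the control qubit. -/
theorem ctrlOp_mul {q : Q} {A : Op Q} (hA : ∀ x y, x q ≠ y q → A x y = 0) (B : Op Q) :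
    ctrlOp q (A * B) = ctrlOp q A * ctrlOp q B := by
  ext x z
  rw [ctrlOp_mul_apply]
  by_cases h : x q
  · simp only [ctrlOp, h, if_true, Matrix.mul_apply]
    refine Finset.sum_congr rfl fun y _ => ?_
    by_cases hxy : x q = y q
    · simp [← hxy, h]
    · simp [hA x y hxy]
  · simp [ctrlOp, h]

theorem ctrlOp_conj {q : Q} {A B : Op Q} (hA : ∀ x y, x q ≠ y q → A x y = 0) (D : Op Q)
    (hAB : A * B = 1) : ctrlOp q (A * D * B) = A * ctrlOp q D * B := by
  have h : ∀ x z, (A * ctrlOp q D) x z = if x q then (A * D) x z else A x z := by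
    intro x z
    simp only [Matrix.mul_apply]
    by_cases h : x q
    · rw [if_pos h]
      refine Finset.sum_congr rfl fun y _ => ?_
      by_cases hxy : x q = y q
      · simp [ctrlOp, ← hxy, h]
      · simp [hA x y hxy]
    · rw [if_neg h]
      refine Eq.trans (Finset.sum_congr rfl fun y _ => ?_)
        ((Matrix.mul_apply (M := A) (N := 1)).symm.trans (by rw [mul_one]))
      by_cases hxy : x q = y q
      · simp [ctrlOp, ← hxy, h]
      · simp [hA x y hxy]
  ext x z
  rw [Matrix.mul_apply]
  simp only [h]
  by_cases hx : x q
  · simp [ctrlOp, hx, Matrix.mul_apply]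
  · simp only [ctrlOp, hx, Bool.false_eq_true, if_false]
    rw [← Matrix.mul_apply, hAB]

/-- A unitary matrix has finite spectrum, so that its argument is a Hermitian matrix `h` with
`u = e^{ih}` in spite of the branch cut; the spectral theorem applies to `h`. -/
theorem exists_unitary_diagonalization {ι : Type*} [Fintype ι] [DecidableEq ι]
    {u : Matrix ι ι ℂ} (hu : u ∈ Matrix.unitaryGroup ι ℂ) :
    ∃ V ∈ Matrix.unitaryGroup ι ℂ, ∃ θ : ι → ℝ,
      u = V * Matrix.diagonal (fun i => Complex.exp (θ i * Complex.I)) * star V := by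
  have hns : IsStarNormal u := ⟨by
    rw [commute_iff_eq, Unitary.star_mul_self_of_mem hu, Unitary.mul_star_self_of_mem hu]⟩
  set h : Matrix ι ι ℂ := cfc (Complex.ofReal ∘ Complex.arg : ℂ → ℂ) u with hh
  have hsa : IsSelfAdjoint h := IsSelfAdjoint.cfc_arg u
  have hfin : (spectrum ℂ u).Finite := u.finite_spectrum
  have hexp : NormedSpace.exp (Complex.I • h) = u := by
    rw [← CFC.exp_eq_normedSpace_exp (𝕜 := ℂ),
      ← cfc_comp_smul Complex.I _ h NormedSpace.exp_continuous.continuousOn, hh,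
      ← cfc_comp' (fun x : ℂ => NormedSpace.exp (Complex.I • x)) _ u
        (NormedSpace.exp_continuous.comp (continuous_const_smul Complex.I)).continuousOn
        (hfin.continuousOn _)]
    conv_rhs => rw [← cfc_id' ℂ u]
    refine cfc_congr fun y hy => ?_
    have hy1 : ‖y‖ = 1 := spectrum.norm_eq_one_of_unitary hu hy
    have h2 := Complex.norm_mul_exp_arg_mul_I y
    rw [hy1, Complex.ofReal_one, one_mul] at h2
    simpa [← Complex.exp_eq_exp_ℂ, mul_comm] using h2
  have hH : h.IsHermitian := hsa
  refine ⟨hH.eigenvectorUnitary, hH.eigenvectorUnitary.2, hH.eigenvalues, ?_⟩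
  have hspec := hH.spectral_theorem
  rw [Unitary.conjStarAlgAut_apply] at hspec
  have hinv : star (hH.eigenvectorUnitary : Matrix ι ι ℂ) =
      (hH.eigenvectorUnitary : Matrix ι ι ℂ)⁻¹ :=
    (Matrix.inv_eq_left_inv (Unitary.star_mul_self_of_mem hH.eigenvectorUnitary.2)).symm
  have hunit : IsUnit (hH.eigenvectorUnitary : Matrix ι ι ℂ) :=
    ⟨Unitary.toUnits hH.eigenvectorUnitary, rfl⟩
  rw [← hexp]
  conv_lhs => rw [hspec]
  rw [hinv, ← Matrix.smul_mul, ← Matrix.mul_smul, ← Matrix.diagonal_smul, Matrix.exp_conj _ _ hunit,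
    Matrix.exp_diagonal]
  congr 3
  funext i
  simp [← Complex.exp_eq_exp_ℂ, Pi.coe_exp, mul_comm]

/-- The controlled-not operation `|x_a, x_b⟩ ↦ |x_a, x_a + x_b⟩`. -/
def cnotOp (a b : K) : Op K :=
  fun x y => if y = Function.update x b (x a ^^ x b) then 1 else 0

theorem update_xor_update_xor {a b : K} (hab : a ≠ b) :
    ∀ x : K → Bool, Function.update (Function.update x b (x a ^^ x b)) b
      (Function.update x b (x a ^^ x b) a ^^ Function.update x b (x a ^^ x b) b) = x := by
  intro x
  simp [Function.update_of_ne hab]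

theorem cnotOp_mul_apply (a b : K) (B : Op K) (x z : K → Bool) :
    (cnotOp a b * B) x z = B (Function.update x b (x a ^^ x b)) z := by
  simp [Matrix.mul_apply, cnotOp]

theorem cnotOp_mul_self {a b : K} (hab : a ≠ b) : cnotOp a b * cnotOp a b = 1 := by
  ext x z
  rw [cnotOp_mul_apply]
  simp only [cnotOp]
  rw [update_xor_update_xor hab x, Matrix.one_apply]
  simp [eq_comm]

theorem cnotOp_mem_unitary {a b : K} (hab : a ≠ b) :
    cnotOp a b ∈ Matrix.unitaryGroup (K → Bool) ℂ := by
  have hstar : star (cnotOp a b) = cnotOp a b := by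
    ext x y
    simp only [Matrix.star_apply, cnotOp, apply_ite star, star_one, star_zero]
    have : x = Function.update y b (y a ^^ y b) ↔ y = Function.update x b (x a ^^ x b) :=
      ⟨fun h => h ▸ (update_xor_update_xor hab y).symm,
        fun h => h ▸ (update_xor_update_xor hab x).symm⟩
    simp [this]
  rw [Matrix.mem_unitaryGroup_iff, hstar, cnotOp_mul_self hab]

theorem isGate_cnotOp {a b : Q} (hab : a ≠ b) : IsGate (cnotOp a b) := by
  have hinj : Function.Injective fun i : Bool => if i then a else b := by
    intro i j
    cases i <;> cases j <;> simp [hab, hab.symm]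
  have h : cnotOp a b = liftOp (fun i : Bool => if i then a else b) (cnotOp true false) := by
    ext x y
    simp only [cnotOp, liftOp, ← ite_and]
    congr 1
    refine propext ⟨?_, ?_⟩
    · rintro rfl
      refine ⟨fun q hq => ?_, ?_⟩
      · have := hq false
        rw [Function.update_of_ne]
        simpa [eq_comm] using this
      · funext i
        cases i <;> simp [Function.update_of_ne hab]
    · rintro ⟨h1, h2⟩
      funext q
      have ht := congrFun h2 true
      have hf := congrFun h2 false
      simp at ht hf
      by_cases hqb : q = b
      · subst hqb
        simp [hf]
      · rw [Function.update_of_ne hqb]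
        by_cases hqa : q = a
        · rw [hqa, ht]
        · exact (h1 q fun i => by cases i <;> simp [Ne.symm hqa, Ne.symm hqb]).symm
  rw [h]
  exact isGate_liftOp hinj (by simp) (cnotOp_mem_unitary (by simp))

theorem cnotOp_conj_diagonal {a b : Q} (hab : a ≠ b) (φ : (Q → Bool) → ℂ) :
    cnotOp a b * Matrix.diagonal φ * cnotOp a b =
      Matrix.diagonal fun x => φ (Function.update x b (x a ^^ x b)) := by
  ext x z
  rw [mul_assoc, cnotOp_mul_apply, Matrix.diagonal_mul]
  simp only [cnotOp]
  rw [update_xor_update_xor hab x, Matrix.diagonal_apply]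
  simp [eq_comm]

/-- Every phase depending on two bits is a sum of phases depending on the first bit, on the second
bit, and on their parity, since `2XY = X + Y - (X ⊕ Y)`. -/
theorem exists_parity_decomposition (θ : Bool → Bool → ℝ) :
    ∃ g h k : Bool → ℝ, ∀ X Y, θ X Y = g X + h Y + k (X ^^ Y) := by
  set γ := θ true true - θ true false - θ false true + θ false false with hγ
  refine ⟨fun X => if X then θ true false + γ / 2 else θ false false,
    fun Y => if Y then θ false true - θ false false + γ / 2 else 0,
    fun Z => if Z then - γ / 2 else 0, ?_⟩
  intro X Y
  cases X <;> cases Y <;> simp [hγ] <;> ring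

/-- A diagonal operator controlled by `q` whose phases depend on two further qubits `a` and `b`.
Its phase splits into three phases, each depending on `q` and one of the bits `x_a`, `x_b` and
`x_a + x_b`; the last one is computed into `b` by a controlled-not. -/
theorem hasCircuit_ctrl_diagonal {q a b : Q} (hqb : q ≠ b) (hab : a ≠ b)
    (θ : Bool → Bool → ℝ) :
    HasCircuit (Matrix.diagonal fun x : Q → Bool =>
      if x q then Complex.exp (θ (x a) (x b) * Complex.I) else 1) 5 := by
  obtain ⟨g, h, k, hghk⟩ := exists_parity_decomposition θ
  have hgate : ∀ (c : Q) (k : Bool → ℝ), IsGate (Matrix.diagonal fun x : Q → Bool =>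
      if x q then Complex.exp (k (x c) * Complex.I) else 1) := by
    intro c k
    refine isGate_diagonal (fun x => ?_) {q, c} Finset.card_le_two fun x y hxy => ?_
    · split_ifs
      · exact Complex.norm_exp_ofReal_mul_I _
      · simp
    · rw [hxy q (by simp), hxy c (by simp)]
  have hdec : (Matrix.diagonal fun x : Q → Bool =>
      if x q then Complex.exp (θ (x a) (x b) * Complex.I) else 1) =
      (Matrix.diagonal fun x : Q → Bool => if x q then Complex.exp (g (x a) * Complex.I) else 1) *
      (Matrix.diagonal fun x : Q → Bool => if x q then Complex.exp (h (x b) * Complex.I) else 1) *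
      (cnotOp a b * (Matrix.diagonal fun x : Q → Bool =>
        if x q then Complex.exp (k (x b) * Complex.I) else 1) * cnotOp a b) := by
    rw [cnotOp_conj_diagonal hab, Matrix.diagonal_mul_diagonal, Matrix.diagonal_mul_diagonal]
    congr 1
    funext x
    by_cases hx : x q
    · simp only [hx, if_true, Function.update_of_ne hqb, Function.update_self, hghk,
        ← Complex.exp_add]
      congr 1
      push_cast
      ring
    · simp [hx, Function.update_of_ne hqb]
  rw [hdec]
  exact ((hgate a g).hasCircuit.mul (hgate b h).hasCircuit).mul
    (((isGate_cnotOp hab).hasCircuit.mul (hgate b k).hasCircuit).mul (isGate_cnotOp hab).hasCircuit)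

/-- A controlled two-qubit gate is a product of seven gates: after diagonalizing the gate only a
diagonal operator has to be controlled. -/
theorem hasCircuit_ctrlOp_liftOp_of_card_le_two {q : Q} {f : K → Q} (hf : f.Injective)
    (hq : ∀ k, f k ≠ q) (hK : Fintype.card K ≤ 2) {u : Op K}
    (hu : u ∈ Matrix.unitaryGroup (K → Bool) ℂ) : HasCircuit (ctrlOp q (liftOp f u)) 7 := by
  obtain ⟨V, hV, θ, rfl⟩ := exists_unitary_diagonalization hu
  rw [liftOp_mul hf, liftOp_mul hf, liftOp_diagonal,
    ctrlOp_conj (fun x y h => liftOp_apply_eq_zero hq V h) _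
      (by rw [← liftOp_mul hf, Unitary.mul_star_self_of_mem hV, liftOp_one])]
  have hctrl : ctrlOp q (Matrix.diagonal fun x : Q → Bool =>
      Complex.exp (θ (x ∘ f) * Complex.I)) =
      Matrix.diagonal fun x : Q → Bool =>
        if x q then Complex.exp (θ (x ∘ f) * Complex.I) else 1 := by
    ext x y
    by_cases hxy : x = y
    · subst hxy
      simp [ctrlOp]
    · simp [ctrlOp, hxy]
  rw [hctrl]
  refine (((isGate_liftOp hf hK hV).hasCircuit.mul (t := 5) ?_).mul
    (isGate_liftOp hf hK (Unitary.star_mem hV)).hasCircuit)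
  rcases hK.lt_or_eq with hlt | heq
  · refine (isGate_diagonal (fun x => ?_) (insert q (Finset.univ.image f)) ?_
      fun x y hxy => ?_).hasCircuit.mono (by norm_num)
    · split_ifs
      · exact Complex.norm_exp_ofReal_mul_I _
      · simp
    · have h1 : (Finset.univ.image f).card ≤ Fintype.card K := Finset.card_image_le
      have h2 := Finset.card_insert_le q (Finset.univ.image f)
      omega
    · have h1 : x ∘ f = y ∘ f := funext fun k => hxy _ (by simp)
      rw [hxy q (by simp), h1]
  · obtain ⟨a, b, hab, huniv⟩ := Finset.card_eq_two.1 (heq : (Finset.univ : Finset K).card = 2)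
    have hfab : ∀ x : Q → Bool, x ∘ f = fun k => if k = a then x (f a) else x (f b) := by
      intro x
      funext k
      have : k ∈ ({a, b} : Finset K) := huniv ▸ Finset.mem_univ k
      rcases (by simpa using this : k = a ∨ k = b) with rfl | rfl
      · simp
      · simp [hab.symm]
    simp only [hfab]
    exact hasCircuit_ctrl_diagonal (hq b).symm (hf.ne hab)
      fun X Y => θ fun k => if k = a then X else Y

/-- Controlling a circuit, gate by gate, increases its size by a factor of seven. -/
theorem HasCircuit.ctrlOp_liftOp {q : Q} {f : P → Q} (hf : f.Injective) (hq : ∀ p, f p ≠ q)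
    {U : Op P} {s : ℕ} (hU : HasCircuit U s) :
    HasCircuit (ctrlOp q (FastForward.liftOp f U)) (7 * s) := by
  refine HasCircuit.of_forall_isGate (Φ := fun A => ctrlOp q (FastForward.liftOp f A)) (r := 7)
    (by rw [liftOp_one, ctrlOp_one]) (fun G B _ => ?_) (fun G hG => ?_) hU
  · rw [liftOp_mul hf, ctrlOp_mul fun x y h => liftOp_apply_eq_zero hq G h]
  · obtain ⟨S, hS, u, hu, rfl⟩ := hG.exists_liftOp
    rw [liftOp_liftOp hf]
    exact hasCircuit_ctrlOp_liftOp_of_card_le_two (hf.comp Subtype.val_injective)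
      (fun k => hq _) (by simpa using hS) hu

end Control

/-! ### The quantum Fourier transform -/

section Fourier

/-- The Hadamard gate on a single qubit. -/
noncomputable def hadamard : Op Unit :=
  fun a b => (Real.sqrt 2 : ℂ)⁻¹ * if a () && b () then -1 else 1

theorem sqrt_two_inv_mul_self : ((Real.sqrt 2 : ℂ)⁻¹) * ((Real.sqrt 2 : ℂ)⁻¹) = 2⁻¹ := by
  rw [← mul_inv, ← Complex.ofReal_mul, Real.mul_self_sqrt (by norm_num)]
  norm_num

theorem sum_unit_bool {M : Type*} [AddCommMonoid M] (g : (Unit → Bool) → M) :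
    ∑ p, g p = g (fun _ => true) + g fun _ => false := by
  rw [← Fintype.sum_equiv (Equiv.funUnique Unit Bool).symm (fun b => g fun _ => b) g
    (fun _ => rfl), Fintype.sum_bool]

theorem hadamard_mem_unitary : hadamard ∈ Matrix.unitaryGroup (Unit → Bool) ℂ := by
  rw [Matrix.mem_unitaryGroup_iff]
  have hstar : ∀ c : Bool, star ((Real.sqrt 2 : ℂ)⁻¹ * if c then -1 else 1) =
      (Real.sqrt 2 : ℂ)⁻¹ * if c then -1 else 1 := by
    intro c
    cases c <;> simp [← starRingEnd_apply]
  ext a b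
  rw [Matrix.mul_apply, sum_unit_bool]
  simp only [Matrix.star_apply, hadamard, hstar]
  have h2 := sqrt_two_inv_mul_self
  have hab : a = b ↔ a () = b () := ⟨fun h => h ▸ rfl, fun h => funext fun _ => h⟩
  rw [Matrix.one_apply]
  simp only [hab]
  cases a () <;> cases b () <;> simp [h2] <;> norm_num

/-- The phase `e^{2πi 2^j / 2^{k+1}}` of the quantum Fourier transform. -/
noncomputable def fourierPhase (k j : ℕ) : ℂ :=
  Complex.exp ((2 * Real.pi * (2 ^ j / 2 ^ (k + 1)) : ℝ) * Complex.I)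

variable {M : ℕ}

/-- The factor contributed by the input bit `z k` to the matrix coefficient `⟨y| F |z⟩` of the
quantum Fourier transform. Only the bits `y j` with `j ≤ k` matter, since the others contribute
integral multiples of `2π` to the phase. -/
noncomputable def fourierFactor (y z : Fin M → Bool) (k : Fin M) : ℂ :=
  (Real.sqrt 2 : ℂ)⁻¹ * (if y k && z k then -1 else 1) *
    ∏ j with j < k, if y j && z k then fourierPhase k j else 1

/-- The first `s` stages of the quantum Fourier transform on `M` qubits. The `k`th stage replaces
the input bit `z k` by the output bit `y k`. For `s = M` this is the matrix
`2^{-M/2} e^{2πi y z / 2^M}`, where the number `y` is read with its least significant bit first, and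
the number `z` with its most significant bit first. -/
noncomputable def fourierStages (M s : ℕ) : Op (Fin M) :=
  fun y z => if ∀ k : Fin M, s ≤ k → y k = z k then
    ∏ k ∈ Finset.univ.filter (fun k : Fin M => (k : ℕ) < s), fourierFactor y z k else 0

theorem fourierStages_zero : fourierStages M 0 = 1 := by
  ext y z
  simp [fourierStages, Matrix.one_apply, funext_iff]

theorem fourierStages_self_apply (y z : Fin M → Bool) :
    fourierStages M M y z = ∏ k, fourierFactor y z k := by
  rw [fourierStages, if_pos fun k hk => absurd k.2 (not_lt.2 hk)]
  simp

theorem extend_const_unit {Q : Type} [DecidableEq Q] (q : Q) (p : Unit → Bool) (x : Q → Bool) :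
    Function.extend (fun _ => q) p x = Function.update x q (p ()) := by
  funext q'
  have hinj : Function.Injective fun _ : Unit => q := fun _ _ _ => rfl
  by_cases h : q' = q
  · subst h
    rw [Function.update_self]
    exact hinj.extend_apply p x ()
  · rw [Function.update_of_ne h]
    exact Function.extend_apply' _ _ _ (by simpa using Ne.symm h)

theorem fourierFactor_update {k l : Fin M} (hl : l < k) (b : Bool) (y z : Fin M → Bool) :
    fourierFactor (Function.update y k b) z l = fourierFactor y z l := by
  unfold fourierFactor
  rw [Function.update_of_ne hl.ne]
  congr 1
  refine Finset.prod_congr rfl fun j hj => ?_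
  have hj' : j < l := by simpa using hj
  rw [Function.update_of_ne (hj'.trans hl).ne]

/-- The `k`th stage of the quantum Fourier transform: phases controlled by the input bit `k` and the
output bits `j < k`, followed by a Hadamard gate on qubit `k`. -/
theorem fourierStages_succ (k : Fin M) :
    fourierStages M (k + 1) = liftOp (fun _ : Unit => k) hadamard *
      (Matrix.diagonal (fun x : Fin M → Bool =>
        ∏ j with j < k, if x j && x k then fourierPhase k j else 1) * fourierStages M k) := by
  ext y z
  rw [liftOp_mul_apply (fun _ _ _ => rfl), sum_unit_bool]
  simp only [extend_const_unit, Matrix.diagonal_mul, hadamard, Function.comp]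
  have hF : ∀ b, fourierStages M k (Function.update y k b) z =
      if b = z k ∧ ∀ l : Fin M, (k : ℕ) + 1 ≤ l → y l = z l then
        ∏ l ∈ Finset.univ.filter (fun l : Fin M => (l : ℕ) < k), fourierFactor y z l else 0 := by
    intro b
    have hiff : (∀ l : Fin M, (k : ℕ) ≤ l → Function.update y k b l = z l) ↔
        (b = z k ∧ ∀ l : Fin M, (k : ℕ) + 1 ≤ l → y l = z l) := by
      constructor
      · intro h
        refine ⟨by simpa using h k le_rfl, fun l hl => ?_⟩
        have hlk : l ≠ k := fun h' => by subst h'; omega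
        simpa [Function.update_of_ne hlk] using h l (by omega)
      · rintro ⟨h1, h2⟩ l hl
        by_cases hlk : l = k
        · subst hlk
          simpa using h1
        · rw [Function.update_of_ne hlk]
          exact h2 l (Nat.lt_of_le_of_ne hl fun h => hlk (Fin.ext h.symm))
    simp only [fourierStages, hiff]
    congr 1
    refine Finset.prod_congr rfl fun l hl => fourierFactor_update ?_ b y z
    exact Fin.lt_def.2 (by simpa using hl)
  have hD : ∀ b, (∏ j with j < k, if Function.update y k b j && Function.update y k b k then
      fourierPhase k j else 1) = ∏ j with j < k, if y j && b then fourierPhase k j else 1 := by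
    intro b
    refine Finset.prod_congr rfl fun j hj => ?_
    have hj' : j < k := by simpa using hj
    rw [Function.update_of_ne hj'.ne, Function.update_self]
  have hprod : ∏ l ∈ Finset.univ.filter (fun l : Fin M => (l : ℕ) < k + 1), fourierFactor y z l =
      fourierFactor y z k *
        ∏ l ∈ Finset.univ.filter (fun l : Fin M => (l : ℕ) < k), fourierFactor y z l := by
    have hins : (Finset.univ.filter fun l : Fin M => (l : ℕ) < k + 1) =
        insert k (Finset.univ.filter fun l : Fin M => (l : ℕ) < k) := by
      ext l
      simp only [Finset.mem_filter, Finset.mem_univ, true_and, Finset.mem_insert, Fin.ext_iff]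
      omega
    rw [hins, Finset.prod_insert (by simp)]
  simp only [hF, hD]
  rw [fourierStages, hprod]
  by_cases hz : ∀ l : Fin M, (k : ℕ) + 1 ≤ l → y l = z l
  · rw [if_pos hz, fourierFactor]
    have hz' := eq_true hz
    simp only [hz', and_true]
    cases hzk : z k <;> simp [mul_assoc]
  · rw [if_neg hz]
    have hz' := eq_false hz
    simp only [hz', and_false, if_false, mul_zero, add_zero]

theorem hasCircuit_fourierStages (s : ℕ) (hs : s ≤ M) :
    HasCircuit (fourierStages M s) (s * M) := by
  induction s with
  | zero => simpa [fourierStages_zero] using HasCircuit.one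
  | succ s ih =>
    have h := fourierStages_succ (⟨s, hs⟩ : Fin M)
    simp only at h
    rw [h, add_mul, add_comm]
    have hdiag := hasCircuit_diagonal_prod (Finset.univ.filter fun j : Fin M => j < ⟨s, hs⟩)
      (fun j x => if x j && x ⟨s, hs⟩ then fourierPhase s j else 1) fun j _ => by
        refine isGate_diagonal (fun x => ?_) {j, ⟨s, hs⟩} Finset.card_le_two fun x y hxy => ?_
        · split_ifs
          · exact Complex.norm_exp_ofReal_mul_I _
          · simp
        · rw [hxy j (by simp), hxy ⟨s, hs⟩ (by simp)]
    have hcard : (Finset.univ.filter fun j : Fin M => j < ⟨s, hs⟩).card = s := by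
      rw [Finset.filter_gt_eq_Iio, Fin.card_Iio]
    rw [hcard] at hdiag
    have hhad : HasCircuit (liftOp (fun _ : Unit => (⟨s, hs⟩ : Fin M)) hadamard) 1 :=
      (isGate_liftOp (fun _ _ _ => rfl) (by simp) hadamard_mem_unitary).hasCircuit
    exact (hhad.mul (hdiag.mul (ih (by omega)))).mono (by rw [one_mul]; omega)

end Fourier

/-! ### Correcting a unitary on a subspace -/

section Perturbation

variable {ι : Type*} [Fintype ι] [DecidableEq ι]

theorem norm_unitary_mul {U : Matrix ι ι ℂ} (hU : U ∈ Matrix.unitaryGroup ι ℂ)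
    (A : Matrix ι ι ℂ) : ‖U * A‖ = ‖A‖ :=
  CStarRing.norm_mem_unitary_mul A hU

theorem norm_mul_unitary {U : Matrix ι ι ℂ} (hU : U ∈ Matrix.unitaryGroup ι ℂ)
    (A : Matrix ι ι ℂ) : ‖A * U‖ = ‖A‖ :=
  CStarRing.norm_mul_mem_unitary A hU

/-- The unitary factor `X (X†X)^{-1/2}` of the polar decomposition of an almost isometric matrix
`X`. It is close to `X`, and agrees with `X` where `X†X` is the identity. -/
theorem exists_unitary_polar {X : Matrix ι ι ℂ} {δ : ℝ} (hδ : ‖star X * X - 1‖ ≤ δ)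
    (hδ1 : δ < 1) :
    ∃ R ∈ Matrix.unitaryGroup ι ℂ, ‖R - X‖ ≤ δ ∧
      ∀ P : Matrix ι ι ℂ, star X * X * P = P → R * P = X * P := by
  have hδ0 : 0 ≤ δ := (norm_nonneg _).trans hδ
  have hH : (star X * X).IsHermitian := Matrix.isHermitian_conjTranspose_mul_self X
  obtain ⟨V, hV, l, hspec⟩ : ∃ V ∈ Matrix.unitaryGroup ι ℂ, ∃ l : ι → ℝ,
      star X * X = V * Matrix.diagonal (fun i => (l i : ℂ)) * star V := by
    refine ⟨hH.eigenvectorUnitary, hH.eigenvectorUnitary.2, hH.eigenvalues, ?_⟩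
    have := hH.spectral_theorem
    rwa [Unitary.conjStarAlgAut_apply] at this
  have hVs : V * star V = 1 := Unitary.mul_star_self_of_mem hV
  have hsV : star V * V = 1 := Unitary.star_mul_self_of_mem hV
  have hconj : ∀ a b : ι → ℂ, V * Matrix.diagonal a * star V * (V * Matrix.diagonal b * star V) =
      V * Matrix.diagonal (fun i => a i * b i) * star V := by
    intro a b
    rw [← Matrix.diagonal_mul_diagonal]
    calc _ = V * Matrix.diagonal a * (star V * V) * Matrix.diagonal b * star V := by
          simp only [mul_assoc]
      _ = _ := by rw [hsV, mul_one]; simp only [mul_assoc]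
  have hone : V * Matrix.diagonal (fun _ => (1 : ℂ)) * star V = 1 := by
    rw [Matrix.diagonal_one, mul_one, hVs]
  have hnorm : ∀ a : ι → ℂ, ‖V * Matrix.diagonal a * star V‖ = ‖a‖ := by
    intro a
    rw [norm_mul_unitary (Unitary.star_mem hV), norm_unitary_mul hV, Matrix.l2_opNorm_diagonal]
  have hsub : ∀ a b : ι → ℂ, V * Matrix.diagonal a * star V - V * Matrix.diagonal b * star V =
      V * Matrix.diagonal (fun i => a i - b i) * star V := by
    intro a b
    rw [← Matrix.diagonal_sub, mul_sub, sub_mul]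
  have hl : ∀ i, |l i - 1| ≤ δ := by
    intro i
    rw [hspec, ← hone, hsub, hnorm] at hδ
    have := (norm_le_pi_norm (fun i => (l i : ℂ) - 1) i).trans hδ
    rwa [← Complex.ofReal_one, ← Complex.ofReal_sub, Complex.norm_real] at this
  have hlpos : ∀ i, 0 < l i := fun i => by have := (abs_le.1 (hl i)).1; linarith
  have hs0 : ∀ i, (Real.sqrt (l i) : ℂ) ≠ 0 := fun i => by
    simpa using (Real.sqrt_pos.2 (hlpos i)).ne'
  have hss : ∀ i, (Real.sqrt (l i) : ℂ) * Real.sqrt (l i) = l i := fun i => by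
    rw [← Complex.ofReal_mul, Real.mul_self_sqrt (hlpos i).le]
  set A := V * Matrix.diagonal (fun i => (Real.sqrt (l i) : ℂ)) * star V with hA
  set B := V * Matrix.diagonal (fun i => (Real.sqrt (l i) : ℂ)⁻¹) * star V with hB
  have hBA : B * A = 1 := by
    rw [hA, hB, hconj]
    simp only [inv_mul_cancel₀ (hs0 _), hone]
  have hBstar : star B = B := by
    rw [hB, star_mul, star_mul, star_star, ← mul_assoc, Matrix.star_eq_conjTranspose
      (Matrix.diagonal _), Matrix.diagonal_conjTranspose]
    congr 3
    funext i
    simp [← starRingEnd_apply]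
  have hR : X * B ∈ Matrix.unitaryGroup ι ℂ := by
    rw [Matrix.mem_unitaryGroup_iff', star_mul, hBstar]
    calc _ = B * (star X * X) * B := by simp only [mul_assoc]
      _ = 1 := by
        rw [hspec, hB, hconj, hconj, ← hone]
        congr 3
        funext i
        rw [← hss i]
        field_simp [hs0 i]
  refine ⟨X * B, hR, ?_, fun P hP => ?_⟩
  · have h1 : X * B - X = X * B * (1 - A) := by rw [mul_sub, mul_one, mul_assoc X, hBA, mul_one]
    rw [h1, norm_unitary_mul hR, ← hone, hA, hsub, hnorm]
    refine (pi_norm_le_iff_of_nonneg hδ0).2 fun i => ?_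
    rw [← Complex.ofReal_one, ← Complex.ofReal_sub, Complex.norm_real, Real.norm_eq_abs]
    have hsq : (1 - Real.sqrt (l i)) * (1 + Real.sqrt (l i)) = 1 - l i := by
      ring_nf
      rw [Real.sq_sqrt (hlpos i).le]
    have h2 : |1 - Real.sqrt (l i)| * (1 + Real.sqrt (l i)) = |l i - 1| := by
      rw [abs_sub_comm (l i), ← hsq, abs_mul, abs_of_pos (by positivity : 0 < 1 + Real.sqrt (l i))]
    have h3 := Real.sqrt_nonneg (l i)
    have h4 := hl i
    nlinarith [abs_nonneg (1 - Real.sqrt (l i))]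
  · rw [mul_assoc]
    congr 1
    have hY : Matrix.diagonal (fun i => (l i : ℂ)) * (star V * P) = star V * P := by
      conv_rhs => rw [← hP, hspec]
      calc _ = (star V * V) * (Matrix.diagonal (fun i => (l i : ℂ)) * (star V * P)) := by
            rw [hsV, one_mul]
        _ = _ := by simp only [mul_assoc]
    have hY' : Matrix.diagonal (fun i => (Real.sqrt (l i) : ℂ)⁻¹) * (star V * P) = star V * P := by
      ext i j
      have hij := congrFun (congrFun hY i) j
      rw [Matrix.diagonal_mul] at hij ⊢
      rcases mul_left_eq_self₀.1 hij with h | h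
      · have : l i = 1 := by exact_mod_cast h
        simp [this]
      · simp [h]
    rw [hB, mul_assoc, mul_assoc, hY', ← mul_assoc, hVs, one_mul]

theorem norm_le_one_of_projection {P : Matrix ι ι ℂ} (hP : star P = P) (hPP : P * P = P) :
    ‖P‖ ≤ 1 := by
  have h := CStarRing.norm_star_mul_self (x := P)
  rw [hP, hPP] at h
  by_contra! h1
  nlinarith

/-- Let two unitaries `U'` and `V` be close on the range of a projection `P`. Then `U'` is close
in operator norm to a unitary that agrees with `V` on the range of `P`. For `W = U'†V` and
`Q = W P W†`, the operator `X = W P + (1 - Q)(1 - P)` is close to the identity, agrees with `W` on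
the range of `P`, and maps the kernel of `P` into the orthogonal complement of `W(range P)`; its
unitary polar factor is the required correction of `U'`. -/
theorem exists_unitary_eq_on_projection {U' V P : Matrix ι ι ℂ}
    (hU' : U' ∈ Matrix.unitaryGroup ι ℂ) (hV : V ∈ Matrix.unitaryGroup ι ℂ)
    (hP : star P = P) (hPP : P * P = P) {ε : ℝ} (hε : ‖(U' - V) * P‖ ≤ ε) (hε1 : 5 * ε < 1) :
    ∃ U ∈ Matrix.unitaryGroup ι ℂ, U * P = V * P ∧ ‖U - U'‖ ≤ 7 * ε := by
  have hε0 : 0 ≤ ε := (norm_nonneg _).trans hε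
  have hU's : star U' ∈ Matrix.unitaryGroup ι ℂ := Unitary.star_mem hU'
  have hUU : U' * star U' = 1 := Unitary.mul_star_self_of_mem hU'
  have hUU' : star U' * U' = 1 := Unitary.star_mul_self_of_mem hU'
  obtain ⟨W, hWdef⟩ : ∃ W, W = star U' * V := ⟨_, rfl⟩
  have hW : W ∈ Matrix.unitaryGroup ι ℂ := hWdef ▸ mul_mem hU's hV
  have hWW : star W * W = 1 := Unitary.star_mul_self_of_mem hW
  have hWP : ‖(W - 1) * P‖ ≤ ε := by
    have : (W - 1) * P = - (star U' * ((U' - V) * P)) := by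
      rw [hWdef, ← mul_assoc, mul_sub, hUU', sub_mul, sub_mul, neg_sub]
    rw [this, norm_neg, norm_unitary_mul hU's]
    exact hε
  obtain ⟨R, hRdef⟩ : ∃ R, R = (1 : Matrix ι ι ℂ) - P := ⟨_, rfl⟩
  have hRs : star R = R := by rw [hRdef, star_sub, star_one, hP]
  have hRR : R * R = R := by rw [hRdef]; noncomm_ring; rw [hPP]; abel
  have hRP : R * P = 0 := by rw [hRdef, sub_mul, hPP, one_mul, sub_self]
  obtain ⟨X, hXdef⟩ : ∃ X, X = W * P + (1 - W * P * star W) * R := ⟨_, rfl⟩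
  have hXP : X * P = W * P := by
    rw [hXdef, add_mul, mul_assoc, hPP, mul_assoc _ R, hRP, mul_zero, add_zero]
  have hQW : (1 - W * P * star W) * (W * P) = 0 := by
    rw [sub_mul, one_mul]
    have : W * P * star W * (W * P) = W * P * (star W * W) * P := by simp only [mul_assoc]
    rw [this, hWW, mul_one, mul_assoc, hPP, sub_self]
  have hXXP : star X * X * P = P := by
    have hXs : star X = P * star W + R * (1 - W * P * star W) := by
      rw [hXdef]
      simp only [star_add, star_mul, star_sub, star_one, star_star, hP, hRs, mul_assoc]
    rw [mul_assoc, hXP, hXs, add_mul, mul_assoc R, hQW, mul_zero, add_zero]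
    have : P * star W * (W * P) = P * (star W * W) * P := by simp only [mul_assoc]
    rw [this, hWW, mul_one, hPP]
  have hX1 : ‖X - 1‖ ≤ 2 * ε := by
    have h1 : X - 1 = (W - 1) * P - W * star (R * ((W - 1) * P)) := by
      have h2 : star (R * ((W - 1) * P)) = P * star W * R := by
        rw [sub_mul, mul_sub, one_mul, hRP, sub_zero, star_mul, star_mul, hRs, hP]
      rw [h2, hXdef, hRdef]
      have h3 : W * (P * star W * (1 - P)) = W * P * star W * (1 - P) := by simp only [mul_assoc]
      rw [h3, sub_mul 1 (W * P * star W), sub_mul W, one_mul, one_mul]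
      abel
    have h2 : ‖R * ((W - 1) * P)‖ ≤ ε :=
      (norm_mul_le _ _).trans ((mul_le_of_le_one_left (norm_nonneg _)
        (norm_le_one_of_projection hRs hRR)).trans hWP)
    rw [h1]
    refine (norm_sub_le _ _).trans ?_
    rw [norm_unitary_mul hW, norm_star]
    linarith
  have hXX : ‖star X * X - 1‖ ≤ 5 * ε := by
    have h1 : star X * X - 1 = star (X - 1) * (X - 1) + (X - 1) + star (X - 1) := by
      rw [star_sub, star_one]
      noncomm_ring
    rw [h1]
    have h2 := norm_add₃_le (a := star (X - 1) * (X - 1)) (b := X - 1) (c := star (X - 1))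
    have h3 := norm_mul_le (star (X - 1)) (X - 1)
    rw [norm_star] at h2 h3
    nlinarith [norm_nonneg (X - 1)]
  obtain ⟨Z, hZ, hZX, hZP⟩ := exists_unitary_polar hXX hε1
  refine ⟨U' * Z, mul_mem hU' hZ, ?_, ?_⟩
  · rw [mul_assoc, hZP P hXXP, hXP, hWdef, ← mul_assoc, ← mul_assoc, hUU, one_mul]
  · have h1 : U' * Z - U' = U' * ((Z - X) + (X - 1)) := by noncomm_ring
    rw [h1, norm_unitary_mul hU']
    refine (norm_add_le _ _).trans ?_
    linarith

end Perturbation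

/-! ### Time evolution -/

section Evolution

theorem exp_mulVec_of_mulVec_eq_smul {ι : Type*} [Fintype ι] [DecidableEq ι]
    {A : Matrix ι ι ℂ} {v : ι → ℂ} {c : ℂ} (h : A *ᵥ v = c • v) :
    NormedSpace.exp A *ᵥ v = Complex.exp c • v := by
  have hpow : ∀ k : ℕ, (A ^ k) *ᵥ v = c ^ k • v := by
    intro k
    induction k with
    | zero => simp
    | succ k ih => rw [pow_succ, ← Matrix.mulVec_mulVec, h, Matrix.mulVec_smul, ih, smul_smul,
        pow_succ, mul_comm]
  let L : Matrix ι ι ℂ →L[ℂ] (ι → ℂ) := LinearMap.toContinuousLinearMap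
    ((Matrix.mulVecBilin ℂ ℂ).flip v)
  have hL : ∀ B, L B = B *ᵥ v := fun B => rfl
  have h1 := (NormedSpace.exp_series_hasSum_exp' (𝕂 := ℂ) A).mapL L
  have h2 := (NormedSpace.exp_series_hasSum_exp' (𝕂 := ℂ) c).smul_const v
  have h3 : ∀ k : ℕ, L ((k.factorial⁻¹ : ℂ) • A ^ k) = ((k.factorial⁻¹ : ℂ) • c ^ k) • v := by
    intro k
    rw [map_smul, hL, hpow, smul_assoc]
  simp only [h3] at h1
  rw [← hL, h1.unique h2, Complex.exp_eq_exp_ℂ]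

variable {n : ℕ} {H : Op (Fin n)}

theorem evolution_mulVec_of_eigenvector {ψ : Ket (Fin n)} {E : ℝ} (h : H *ᵥ ψ = (E : ℂ) • ψ)
    (t : ℝ) : evolution H t *ᵥ ψ = Complex.exp ((-(E * t) : ℝ) * Complex.I) • ψ := by
  rw [evolution, exp_mulVec_of_mulVec_eq_smul (c := (-(E * t) : ℝ) * Complex.I)]
  rw [Matrix.smul_mulVec, h, smul_smul]
  congr 1
  push_cast
  ring

theorem evolution_mem_unitary (hH : H.IsHermitian) (t : ℝ) :
    evolution H t ∈ Matrix.unitaryGroup (Fin n → Bool) ℂ := by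
  have hstar : star ((-(Complex.I * (t : ℂ))) • H) = - ((-(Complex.I * (t : ℂ))) • H) := by
    rw [star_smul, Matrix.star_eq_conjTranspose, hH.eq, ← neg_smul]
    congr 1
    simp [← starRingEnd_apply]
  let _ : NormedAlgebra ℚ (Op (Fin n)) := NormedAlgebra.restrictScalars ℚ ℂ _
  exact NormedSpace.exp_mem_unitary_of_mem_skewAdjoint hstar

theorem abs_eigenvalue_le (hH : ‖H‖ = 1) {ψ : Ket (Fin n)} {E : ℝ} (hψ : ketNorm ψ = 1)
    (h : H *ᵥ ψ = (E : ℂ) • ψ) : |E| ≤ 1 := by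
  have h1 := ketNorm_mulVec_le H ψ
  rw [h, ketNorm_smul, hH, hψ] at h1
  simpa using h1

end Evolution

/-! ### The amplitudes of phase estimation -/

section Amplitude

/-- The contribution of the bit `j` to the number denoted by an output register. -/
noncomputable def outcomeWeight (m f : ℕ) (j : Fin (m + 1)) : ℝ :=
  (if j = Fin.last m then -2 ^ m else 2 ^ (j : ℕ)) / 2 ^ f

theorem outcome_eq_sum {m : ℕ} (f : ℕ) (x : Fin (m + 1) → Bool) :
    outcome f x = ∑ j, if x j then outcomeWeight m f j else 0 := by
  rw [outcome, Fin.sum_univ_castSucc, sub_div, Finset.sum_div, sub_eq_add_neg]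
  congr 1
  · refine Finset.sum_congr rfl fun j _ => ?_
    rw [outcomeWeight, if_neg (Fin.castSucc_lt_last j).ne]
    split_ifs <;> simp
  · rw [outcomeWeight, if_pos rfl]
    split_ifs <;> simp [neg_div]

theorem abs_outcome_le {m : ℕ} (hm : 1 ≤ m) (x : Fin (m + 1) → Bool) :
    |outcome (m - 1) x| ≤ 2 := by
  obtain ⟨l, rfl⟩ : ∃ l, m = l + 1 := ⟨m - 1, by omega⟩
  have h1 : ∑ j : Fin (l + 1), (if x j.castSucc then (2 : ℝ) ^ (j : ℕ) else 0) ≤ 2 ^ (l + 1) := by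
    refine (Finset.sum_le_sum (g := fun j : Fin (l + 1) => (2 : ℝ) ^ (j : ℕ)) fun j _ => ?_).trans ?_
    · split_ifs
      · exact le_rfl
      · positivity
    · rw [Fin.sum_univ_eq_sum_range fun j => (2 : ℝ) ^ j, geom_sum_eq (by norm_num)]
      norm_num
  have h0 : 0 ≤ ∑ j : Fin (l + 1), (if x j.castSucc then (2 : ℝ) ^ (j : ℕ) else 0) :=
    Finset.sum_nonneg fun j _ => by split_ifs <;> positivity
  have hpos : (0 : ℝ) < 2 ^ l := by positivity
  rw [outcome, Nat.add_sub_cancel, abs_div, abs_of_pos hpos, div_le_iff₀ hpos, abs_le]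
  rw [pow_succ] at h1 ⊢
  split_ifs <;> constructor <;> linarith

theorem exp_two_pi_int_mul_I (z : ℤ) : Complex.exp ((2 * Real.pi * z : ℝ) * Complex.I) = 1 := by
  rw [Complex.exp_eq_one_iff]
  exact ⟨z, by push_cast; ring⟩

/-- Two's complement is harmless for the phases: the sign bit contributes `-2^m` instead of `2^m`,
which differs from it by a multiple of the modulus `2^{m+1}`. -/
theorem exp_outcomeWeight {m : ℕ} (hm : 1 ≤ m) (k j : Fin (m + 1)) :
    Complex.exp ((2 * Real.pi * (2 ^ (m - k) * outcomeWeight m (m - 1) j / 4) : ℝ) * Complex.I) =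
      if j = k then -1 else if j < k then fourierPhase k j else 1 := by
  have hk : (k : ℕ) ≤ m := by omega
  have hw : ∀ c : ℝ, (2 : ℝ) ^ (m - k) * (c / 2 ^ (m - 1)) / 4 = c / 2 ^ ((k : ℕ) + 1) := by
    intro c
    have h1 : (2 : ℝ) ^ m = 2 ^ (m - k) * 2 ^ (k : ℕ) := by rw [← pow_add]; congr 1; omega
    have h2 : (2 : ℝ) ^ m = 2 ^ (m - 1) * 2 := by rw [← pow_succ]; congr 1; omega
    have h3 : (2 : ℝ) ^ (m - k) * 2 ^ (k : ℕ) = 2 ^ (m - 1) * 2 := h1 ▸ h2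
    rw [pow_succ]
    field_simp
    linear_combination c * 2 * h3
  rw [outcomeWeight, hw]
  rcases lt_trichotomy j k with hjk | hjk | hjk
  · have hj : j ≠ Fin.last m := ((hjk.trans_le (Fin.le_last k))).ne
    rw [if_neg hj, if_neg hjk.ne, if_pos hjk, fourierPhase]
  · subst hjk
    rw [if_pos rfl]
    have h2 : ∀ s : ℝ, s * 2 ^ (j : ℕ) / 2 ^ ((j : ℕ) + 1) = s / 2 := by
      intro s
      rw [pow_succ]
      field_simp
    by_cases hj : j = Fin.last m
    · have hjm : (j : ℕ) = m := by rw [hj]; rfl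
      rw [if_pos hj, show -(2 : ℝ) ^ m = (-1) * 2 ^ (j : ℕ) by rw [hjm]; ring, h2]
      rw [show ((2 * Real.pi * (-1 / 2) : ℝ) : ℂ) * Complex.I = - (Real.pi * Complex.I) by
        push_cast; ring, Complex.exp_neg, Complex.exp_pi_mul_I]
      norm_num
    · rw [if_neg hj, ← one_mul ((2 : ℝ) ^ (j : ℕ)), h2]
      rw [show ((2 * Real.pi * (1 / 2) : ℝ) : ℂ) * Complex.I = Real.pi * Complex.I by
        push_cast; ring, Complex.exp_pi_mul_I]
  · have hjk' : (k : ℕ) < j := hjk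
    rw [if_neg hjk.ne', if_neg hjk.not_gt]
    have h2 : ∀ s : ℝ, s * 2 ^ (j : ℕ) / 2 ^ ((k : ℕ) + 1) = s * 2 ^ ((j : ℕ) - (k + 1)) := by
      intro s
      rw [div_eq_iff (by positivity), mul_assoc, ← pow_add]
      congr 2
      omega
    by_cases hj : j = Fin.last m
    · have hjm : (j : ℕ) = m := by rw [hj]; rfl
      rw [if_pos hj, show -(2 : ℝ) ^ m = (-1) * 2 ^ (j : ℕ) by rw [hjm]; ring, h2]
      simpa using exp_two_pi_int_mul_I (-1 * 2 ^ ((j : ℕ) - (k + 1)))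
    · rw [if_neg hj, ← one_mul ((2 : ℝ) ^ (j : ℕ)), h2]
      simpa using exp_two_pi_int_mul_I (1 * 2 ^ ((j : ℕ) - (k + 1)))

theorem exp_outcome {m : ℕ} (hm : 1 ≤ m) (k : Fin (m + 1)) (y : Fin (m + 1) → Bool) :
    Complex.exp ((2 * Real.pi * (2 ^ (m - k) * outcome (m - 1) y / 4) : ℝ) * Complex.I) =
      (if y k then -1 else 1) * ∏ j with j < k, if y j then fourierPhase k j else 1 := by
  have h1 : ((2 * Real.pi * (2 ^ (m - k) * outcome (m - 1) y / 4) : ℝ) : ℂ) * Complex.I =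
      ∑ j, if y j then
        ((2 * Real.pi * (2 ^ (m - k) * outcomeWeight m (m - 1) j / 4) : ℝ) : ℂ) * Complex.I
      else 0 := by
    rw [outcome_eq_sum, Finset.mul_sum, Finset.sum_div, Finset.mul_sum, Complex.ofReal_sum,
      Finset.sum_mul]
    refine Finset.sum_congr rfl fun j _ => ?_
    split_ifs <;> simp
  rw [h1, Complex.exp_sum]
  have h2 : ∀ j, Complex.exp (if y j then
        ((2 * Real.pi * (2 ^ (m - k) * outcomeWeight m (m - 1) j / 4) : ℝ) : ℂ) * Complex.I
      else 0) = (if j = k then (if y k then -1 else 1) else 1) *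
        (if j < k then (if y j then fourierPhase k j else 1) else 1) := by
    intro j
    rw [apply_ite Complex.exp, Complex.exp_zero, exp_outcomeWeight hm]
    by_cases hjk : j = k
    · subst hjk
      simp
    · simp only [hjk, if_false, one_mul]
      split_ifs <;> rfl
  simp only [h2, Finset.prod_mul_distrib, Finset.prod_filter]
  simp

/-- The amplitude of the outcome `y` in phase estimation with `m + 1` output qubits, applied to an
eigenstate of energy `E`. -/
noncomputable def estimateAmplitude {m : ℕ} (E : ℝ) (y : Fin (m + 1) → Bool) : ℂ :=
  ∏ k : Fin (m + 1),
    (1 + Complex.exp ((2 * Real.pi * ((outcome (m - 1) y - E) / 4) : ℝ) * Complex.I) ^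
      2 ^ (m - k : ℕ)) / 2

/-- The outcome amplitudes of phase estimation, for an eigenstate of energy `E`: the Fourier transform
is applied to the superposition of all `|z⟩` with the phases that the controlled evolutions have
attached to them. The bit `k` controls the evolution for the time `2^{m-k} π / 2`, since the Fourier
transform reads its input with the most significant bit first. -/
theorem fourier_mulVec_phases {m : ℕ} (hm : 1 ≤ m) (E : ℝ) (t : Fin (m + 1) → ℝ)
    (ht : ∀ k, t k = 2 ^ (m - k : ℕ) * (Real.pi / 2)) :
    fourierStages (m + 1) (m + 1) *ᵥ (fun z =>
      (∏ k, if z k then Complex.exp ((-(E * t k) : ℝ) * Complex.I) else 1) *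
        (fourierStages (m + 1) (m + 1) *ᵥ ketZero (Fin (m + 1))) z) = estimateAmplitude E := by
  funext y
  have h0 : ∀ z : Fin (m + 1) → Bool, (fourierStages (m + 1) (m + 1) *ᵥ ketZero (Fin (m + 1))) z =
      ∏ _k : Fin (m + 1), (Real.sqrt 2 : ℂ)⁻¹ := by
    intro z
    rw [ketZero, ket, Matrix.mulVec_single_one, Matrix.col_apply, fourierStages_self_apply]
    refine Finset.prod_congr rfl fun k _ => ?_
    simp [fourierFactor]
  rw [Matrix.mulVec, dotProduct]
  simp only [h0, fourierStages_self_apply, ← Finset.prod_mul_distrib]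
  set g : Fin (m + 1) → Bool → ℂ := fun k b =>
    (Real.sqrt 2 : ℂ)⁻¹ * (if y k && b then -1 else 1) *
      (∏ j with j < k, if y j && b then fourierPhase k j else 1) *
      ((if b then Complex.exp ((-(E * t k) : ℝ) * Complex.I) else 1) * (Real.sqrt 2 : ℂ)⁻¹) with hg
  have h1 : ∀ z : Fin (m + 1) → Bool, ∏ k, (fourierFactor y z k *
      ((if z k then Complex.exp ((-(E * t k) : ℝ) * Complex.I) else 1) * (Real.sqrt 2 : ℂ)⁻¹)) =
      ∏ k, g k (z k) := fun z => rfl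
  simp only [h1]
  rw [← Fintype.piFinset_univ, ← Finset.prod_univ_sum, estimateAmplitude]
  refine Finset.prod_congr rfl fun k _ => ?_
  have h2 := sqrt_two_inv_mul_self
  have h3 : Complex.exp ((2 * Real.pi * ((outcome (m - 1) y - E) / 4) : ℝ) * Complex.I) ^
      2 ^ (m - k : ℕ) = Complex.exp ((-(E * t k) : ℝ) * Complex.I) *
        ((if y k then -1 else 1) * ∏ j with j < k, if y j then fourierPhase k j else 1) := by
    rw [← exp_outcome hm, ← Complex.exp_add, ← Complex.exp_nat_mul, ht]
    congr 1
    push_cast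
    ring
  rw [h3, Fintype.sum_bool, hg]
  simp only [Bool.and_true, Bool.and_false, Bool.false_eq_true, if_false, if_true,
    Finset.prod_const_one]
  linear_combination (1 + Complex.exp ((-(E * t k) : ℝ) * Complex.I) *
        ((if y k then -1 else 1) * ∏ j with j < k, if y j then fourierPhase k j else 1)) * h2

theorem one_sub_mul_prod_one_add_pow (ω : ℂ) (M : ℕ) :
    (1 - ω) * ∏ i ∈ Finset.range M, (1 + ω ^ 2 ^ i) = 1 - ω ^ 2 ^ M := by
  induction M with
  | zero => simp
  | succ M ih => rw [Finset.prod_range_succ, ← mul_assoc, ih, pow_succ 2, pow_mul]; ring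

/-- The range `|x| ≤ 3 / 4` accommodates the difference of an outcome in `[-2, 2)` and an energy in
`[-1, 1]`, divided by `4`. -/
theorem two_thirds_mul_abs_le_abs_sin {x : ℝ} (hx : |x| ≤ 3 / 4) :
    2 / 3 * |x| ≤ |Real.sin (Real.pi * x)| := by
  have key : ∀ y : ℝ, 0 ≤ y → y ≤ 3 / 4 → 2 / 3 * y ≤ Real.sin (Real.pi * y) := by
    intro y hy0 hy
    have hpi := Real.pi_pos
    rcases le_total y (1 / 2) with h | h
    · have h1 := Real.mul_le_sin (x := Real.pi * y) (by positivity) (by nlinarith)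
      have h2 : 2 / Real.pi * (Real.pi * y) = 2 * y := by field_simp
      linarith
    · have h1 := Real.mul_le_sin (x := Real.pi * (1 - y)) (by nlinarith) (by nlinarith)
      have h2 : 2 / Real.pi * (Real.pi * (1 - y)) = 2 * (1 - y) := by field_simp
      rw [show Real.pi * (1 - y) = Real.pi - Real.pi * y by ring, Real.sin_pi_sub] at h1
      rw [show Real.pi * (1 - y) = Real.pi - Real.pi * y by ring] at h2
      linarith
  rcases le_total 0 x with h | h
  · rw [abs_of_nonneg h] at hx ⊢
    exact (key x h hx).trans (le_abs_self _)
  · rw [abs_of_nonpos h] at hx ⊢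
    have h1 := key (-x) (by linarith) hx
    rw [mul_neg Real.pi, Real.sin_neg] at h1
    exact h1.trans (neg_le_abs _)

/-- Outcomes that are off by more than `δ` have amplitude `O(1 / (2^{m + 1} δ))`, by summing a
geometric series. -/
theorem norm_estimateAmplitude_le {m : ℕ} (hm : 1 ≤ m) {E δ : ℝ} (hE : |E| ≤ 1) (hδ : 0 < δ)
    {y : Fin (m + 1) → Bool} (hy : δ < |E - outcome (m - 1) y|) :
    ‖estimateAmplitude E y‖ ≤ 6 / (2 ^ (m + 1) * δ) := by
  set x := (outcome (m - 1) y - E) / 4 with hx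
  set ω := Complex.exp ((2 * Real.pi * x : ℝ) * Complex.I) with hω
  have hprod : estimateAmplitude E y =
      (∏ i ∈ Finset.range (m + 1), (1 + ω ^ 2 ^ i)) / 2 ^ (m + 1) := by
    rw [estimateAmplitude, Finset.prod_div_distrib, Finset.prod_const, Finset.card_univ,
      Fintype.card_fin, Fin.prod_univ_eq_prod_range (fun k => 1 + ω ^ 2 ^ (m - k)),
      ← Finset.prod_range_reflect]
    congr 1
    refine Finset.prod_congr rfl fun i hi => ?_
    have := Finset.mem_range.1 hi
    congr 3
    omega
  have hω1 : ‖ω‖ = 1 := Complex.norm_exp_ofReal_mul_I _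
  have hgeom := congrArg norm (one_sub_mul_prod_one_add_pow ω (m + 1))
  have hright : ‖1 - ω ^ 2 ^ (m + 1)‖ ≤ 2 := by
    refine (norm_sub_le _ _).trans ?_
    rw [norm_pow, hω1]
    norm_num
  have habs : |x| = |E - outcome (m - 1) y| / 4 := by
    rw [hx, abs_div, abs_sub_comm]
    norm_num
  have hx34 : |x| ≤ 3 / 4 := by
    have h1 := abs_sub E (outcome (m - 1) y)
    have h2 := abs_outcome_le hm y
    rw [habs]
    linarith
  have hleft : δ / 3 ≤ ‖1 - ω‖ := by
    have h1 : ‖1 - ω‖ = 2 * |Real.sin (Real.pi * x)| := by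
      rw [norm_sub_rev, hω, mul_comm _ Complex.I, Complex.norm_exp_I_mul_ofReal_sub_one, norm_mul]
      norm_num
      congr 2
      ring
    have h2 := two_thirds_mul_abs_le_abs_sin hx34
    rw [h1]
    rw [habs] at h2
    linarith
  rw [norm_mul] at hgeom
  rw [hprod, norm_div, norm_pow, Complex.norm_ofNat,
    div_le_div_iff₀ (by positivity) (by positivity)]
  set p := ‖∏ i ∈ Finset.range (m + 1), (1 + ω ^ 2 ^ i)‖
  have hp : 0 ≤ p := norm_nonneg _
  have h6 : p * δ ≤ 6 := by nlinarith
  have hN : (0 : ℝ) < 2 ^ (m + 1) := by positivity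
  nlinarith

open Classical in
/-- There are only `2^{m+1}` outcomes, so that the union bound suffices for the tail. -/
theorem one_sub_le_sum_estimateAmplitude {m : ℕ} (hm : 1 ≤ m) {E δ : ℝ} (hE : |E| ≤ 1)
    (hδ : 0 < δ) (hsum : ∑ y : Fin (m + 1) → Bool, ‖estimateAmplitude E y‖ ^ 2 = 1) :
    1 - 36 / (2 ^ (m + 1) * δ ^ 2) ≤
      ∑ y : Fin (m + 1) → Bool with |E - outcome (m - 1) y| ≤ δ, ‖estimateAmplitude E y‖ ^ 2 := by
  rw [← Finset.sum_filter_add_sum_filter_not _ fun y => |E - outcome (m - 1) y| ≤ δ] at hsum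
  have hbad : ∑ y : Fin (m + 1) → Bool with ¬ |E - outcome (m - 1) y| ≤ δ,
      ‖estimateAmplitude E y‖ ^ 2 ≤ 36 / (2 ^ (m + 1) * δ ^ 2) := by
    refine (Finset.sum_le_card_nsmul _ _ ((6 / (2 ^ (m + 1) * δ)) ^ 2) fun y hy => ?_).trans ?_
    · simp only [Finset.mem_filter, Finset.mem_univ, true_and, not_le] at hy
      exact pow_le_pow_left₀ (norm_nonneg _) (norm_estimateAmplitude_le hm hE hδ hy) 2
    · have hcard : ((Finset.univ.filter fun y : Fin (m + 1) → Bool =>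
          ¬ |E - outcome (m - 1) y| ≤ δ).card : ℝ) ≤ 2 ^ (m + 1) := by
        exact_mod_cast (Finset.card_le_univ _).trans (by simp)
      rw [nsmul_eq_mul]
      refine (mul_le_mul_of_nonneg_right hcard (by positivity)).trans (le_of_eq ?_)
      field_simp
      norm_num
  linarith

end Amplitude

/-! ### Product vectors -/

section Tensor

variable {P Q : Type} [Fintype P] [DecidableEq P] [Fintype Q] [DecidableEq Q]

theorem extend_inl (p : P → Bool) (x : P ⊕ Q → Bool) :
    Function.extend Sum.inl p x = Sum.elim p (x ∘ Sum.inr) := by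
  funext i
  rcases i with i | j
  · exact Sum.inl_injective.extend_apply p x i
  · exact Function.extend_apply' _ _ _ (by simp)

theorem extend_inr (p : Q → Bool) (x : P ⊕ Q → Bool) :
    Function.extend Sum.inr p x = Sum.elim (x ∘ Sum.inl) p := by
  funext i
  rcases i with i | j
  · exact Function.extend_apply' _ _ _ (by simp)
  · exact Sum.inr_injective.extend_apply p x j

theorem liftOp_inl_mulVec_tensorKet (A : Op P) (v : Ket P) (w : Ket Q) :
    liftOp Sum.inl A *ᵥ tensorKet v w = tensorKet (A *ᵥ v) w := by
  funext x
  rw [liftOp_mulVec Sum.inl_injective]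
  simp only [extend_inl, tensorKet, Sum.elim_inl, Sum.elim_inr, Matrix.mulVec, dotProduct,
    Finset.sum_mul, mul_assoc]
  rfl

theorem liftOp_inr_mulVec_tensorKet (A : Op Q) (v : Ket P) (w : Ket Q) :
    liftOp Sum.inr A *ᵥ tensorKet v w = tensorKet v (A *ᵥ w) := by
  funext x
  rw [liftOp_mulVec Sum.inr_injective]
  simp only [extend_inr, tensorKet, Sum.elim_inl, Sum.elim_inr, Matrix.mulVec, dotProduct,
    Finset.mul_sum]
  exact Finset.sum_congr rfl fun p _ => mul_left_comm _ _ _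

theorem tensorOp_one_eq_liftOp (A : Op P) : tensorOp A (1 : Op Q) = liftOp Sum.inl A := by
  ext x y
  have hiff : (∀ q : P ⊕ Q, (∀ p, Sum.inl p ≠ q) → x q = y q) ↔
      (fun q => x (Sum.inr q)) = fun q => y (Sum.inr q) := by
    rw [funext_iff]
    simp
  simp only [tensorOp, liftOp, hiff, Matrix.one_apply]
  split_ifs
  · simp
    rfl
  · simp

theorem sum_sum_register {M : Type*} [AddCommMonoid M] (g : (P ⊕ Q → Bool) → M) :
    ∑ x, g x = ∑ p : P → Bool, ∑ q : Q → Bool, g (Sum.elim p q) := by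
  rw [← Fintype.sum_prod_type']
  exact Fintype.sum_equiv (Equiv.sumArrowEquivProdArrow P Q Bool) _ _ fun x => by
    simp [Equiv.sumArrowEquivProdArrow]

theorem ketNorm_tensorKet (v : Ket P) (w : Ket Q) :
    ketNorm (tensorKet v w) = ketNorm v * ketNorm w := by
  refine (pow_left_inj₀ (ketNorm_nonneg _)
    (mul_nonneg (ketNorm_nonneg v) (ketNorm_nonneg w)) two_ne_zero).1 ?_
  rw [mul_pow, ketNorm_sq, ketNorm_sq, ketNorm_sq, sum_sum_register, Finset.sum_mul_sum]
  simp only [tensorKet, Sum.elim_inl, Sum.elim_inr, norm_mul, mul_pow]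

theorem ketNorm_ketZero : ketNorm (ketZero Q) = 1 := by
  refine (pow_left_inj₀ (ketNorm_nonneg _) zero_le_one two_ne_zero).1 ?_
  rw [ketNorm_sq, ketZero, ket, one_pow, Finset.sum_eq_single fun _ => false]
  · simp
  · intro x _ hx
    simp [Pi.single_eq_of_ne hx]
  · simp

theorem tensorKet_smul_left (c : ℂ) (v : Ket P) (w : Ket Q) :
    tensorKet (c • v) w = c • tensorKet v w := by
  funext x
  simp [tensorKet, mul_assoc]

theorem sum_smul_tensorKet_ket (a : Ket P) (g : Ket Q) :
    ∑ x, a x • tensorKet (ket x) g = tensorKet a g := by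
  funext y
  simp [tensorKet, ket, Finset.sum_apply, Pi.single_apply]

end Tensor

/-! ### Phase estimation with fast forwarding -/

section PhaseEstimation

/-- The vectors of a register `P ⊕ Q` in which all the qubits of `Q` are in the state `|0⟩`. -/
def VanishesOffZero {P Q : Type} (v : Ket (P ⊕ Q)) : Prop :=
  ∀ x j, x (Sum.inr j) = true → v x = 0

theorem VanishesOffZero.eq_tensorKet {P Q : Type} [Fintype Q] [DecidableEq Q] {v : Ket (P ⊕ Q)}
    (hv : VanishesOffZero v) :
    v = tensorKet (fun s => v (Sum.elim s fun _ => false)) (ketZero Q) := by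
  funext x
  by_cases h : ∃ j, x (Sum.inr j) = true
  · obtain ⟨j, hj⟩ := h
    rw [hv x j hj, tensorKet, ketZero, ket, Pi.single_eq_of_ne, mul_zero]
    intro h0
    simpa [hj] using congrFun h0 j
  · push Not at h
    have h0 : (fun q => x (Sum.inr q)) = fun _ => false := by
      funext q
      simpa using h q
    have hx : x = Sum.elim (fun p => x (Sum.inl p)) fun _ => false := by
      funext i
      rcases i with i | j
      · rfl
      · exact congrFun h0 j
    rw [tensorKet, ketZero, ket, h0, Pi.single_eq_same, mul_one, ← hx]

/-- The error of a fast-forwarding circuit on arbitrary vectors, by homogeneity. -/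
theorem ketNorm_mulVec_tensorKet_ketZero_le {P Q : Type} [Fintype P] [DecidableEq P] [Fintype Q]
    [DecidableEq Q] {A : Op (P ⊕ Q)} {α : ℝ}
    (h : ∀ ψ : Ket P, ketNorm ψ = 1 → ketNorm (A *ᵥ tensorKet ψ (ketZero Q)) ≤ α) (ψ : Ket P) :
    ketNorm (A *ᵥ tensorKet ψ (ketZero Q)) ≤ α * ketNorm ψ := by
  by_cases h0 : ketNorm ψ = 0
  · have h1 : tensorKet ψ (ketZero Q) = 0 :=
      ketNorm_eq_zero.1 (by rw [ketNorm_tensorKet, h0, zero_mul])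
    rw [h1, Matrix.mulVec_zero, ketNorm_zero, h0, mul_zero]
  · have hpos : 0 < ketNorm ψ := (ketNorm_nonneg ψ).lt_of_ne' h0
    have hnorm : ‖((ketNorm ψ)⁻¹ : ℂ)‖ = (ketNorm ψ)⁻¹ := by
      rw [norm_inv, Complex.norm_real, Real.norm_of_nonneg hpos.le]
    have h1 := h (((ketNorm ψ)⁻¹ : ℂ) • ψ) (by
      rw [ketNorm_smul, hnorm, inv_mul_cancel₀ h0])
    rw [tensorKet_smul_left, Matrix.mulVec_smul, ketNorm_smul, hnorm] at h1
    rwa [inv_mul_le_iff₀ hpos, mul_comm] at h1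

variable {n m w : ℕ}

/-- The vectors of the system, the output register and the work register whose work register is
in the state `|0⋯0⟩`. -/
def WorkZero (v : Ket (Fin n ⊕ (Fin m ⊕ Fin w))) : Prop :=
  ∀ x j, x (Sum.inr (Sum.inr j)) = true → v x = 0

theorem WorkZero.liftOp_mulVec {P : Type} [Fintype P] [DecidableEq P]
    {v : Ket (Fin n ⊕ (Fin m ⊕ Fin w))} (hv : WorkZero v) {f : P → Fin n ⊕ (Fin m ⊕ Fin w)}
    (hf : f.Injective) (hfw : ∀ p j, f p ≠ Sum.inr (Sum.inr j)) (A : Op P) :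
    WorkZero (liftOp f A *ᵥ v) := by
  intro x j hx
  rw [FastForward.liftOp_mulVec hf]
  refine Finset.sum_eq_zero fun p _ => ?_
  rw [hv _ j (by rw [extend_eq_of_forall_ne fun p => hfw p j, hx]), mul_zero]

theorem WorkZero.ctrlOp_mulVec {v : Ket (Fin n ⊕ (Fin m ⊕ Fin w))} (hv : WorkZero v)
    {A : Op (Fin n ⊕ (Fin m ⊕ Fin w))} (hA : WorkZero (A *ᵥ v)) (q : Fin n ⊕ (Fin m ⊕ Fin w)) :
    WorkZero (ctrlOp q A *ᵥ v) := by
  intro x j hx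
  rw [FastForward.ctrlOp_mulVec, hA x j hx, hv x j hx, ite_self]

/-- The evolution controlled by the output qubit `k`. -/
noncomputable def ctrlEvolution (w : ℕ) (e : Op (Fin n)) (k : Fin m) :
    Op (Fin n ⊕ (Fin m ⊕ Fin w)) :=
  ctrlOp (Sum.inr (Sum.inl k)) (liftOp Sum.inl e)

/-- The approximate evolution `u`, using `c` work qubits, controlled by the output qubit `k`. -/
noncomputable def ctrlApprox {c : ℕ} (hc : c ≤ w) (u : Op (Fin n ⊕ Fin c)) (k : Fin m) :
    Op (Fin n ⊕ (Fin m ⊕ Fin w)) :=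
  ctrlOp (Sum.inr (Sum.inl k))
    (liftOp (Sum.map id fun j => Sum.inr (Fin.castLE hc j)) u)

theorem injective_sumMap_castLE {c : ℕ} (hc : c ≤ w) : Function.Injective
    (Sum.map id fun j => Sum.inr (Fin.castLE hc j) : Fin n ⊕ Fin c → Fin n ⊕ (Fin m ⊕ Fin w)) :=
  Sum.map_injective.2 ⟨Function.injective_id,
    Sum.inr_injective.comp (Fin.castLE_injective hc)⟩

theorem HasCircuit.ctrlApprox {c s : ℕ} (hc : c ≤ w) {u : Op (Fin n ⊕ Fin c)}
    (hu : HasCircuit u s) (k : Fin m) : HasCircuit (ctrlApprox hc u k) (7 * s) :=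
  hu.ctrlOp_liftOp (injective_sumMap_castLE hc) (by rintro (p | p) <;> simp)

theorem ctrlOp_mem_unitary_of_liftOp {P Q : Type} [Fintype P] [DecidableEq P] [Fintype Q]
    [DecidableEq Q] {q : Q} {f : P → Q} (hf : f.Injective) (hq : ∀ p, f p ≠ q) {A : Op P}
    (hA : A ∈ Matrix.unitaryGroup (P → Bool) ℂ) :
    ctrlOp q (liftOp f A) ∈ Matrix.unitaryGroup (Q → Bool) ℂ := by
  have hstar : star (ctrlOp q (liftOp f A)) = ctrlOp q (liftOp f (star A)) := by
    rw [liftOp_star]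
    ext x y
    simp only [Matrix.star_apply, ctrlOp]
    by_cases hxy : x q = y q
    · by_cases h : x q
      · simp [← hxy, h]
      · simp [← hxy, h, Matrix.one_apply, eq_comm]
    · have h1 : x ≠ y := fun h => hxy (h ▸ rfl)
      simp [liftOp_apply_eq_zero hq A (Ne.symm hxy), Matrix.one_apply_ne h1,
        Matrix.one_apply_ne h1.symm]
  rw [Matrix.mem_unitaryGroup_iff, hstar,
    ← ctrlOp_mul fun x y h => liftOp_apply_eq_zero hq A h, ← liftOp_mul hf,
    Matrix.mem_unitaryGroup_iff.1 hA, liftOp_one, ctrlOp_one]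

theorem ctrlEvolution_mem_unitary {e : Op (Fin n)}
    (he : e ∈ Matrix.unitaryGroup (Fin n → Bool) ℂ) (k : Fin m) :
    ctrlEvolution w e k ∈ Matrix.unitaryGroup (Fin n ⊕ (Fin m ⊕ Fin w) → Bool) ℂ :=
  ctrlOp_mem_unitary_of_liftOp Sum.inl_injective (by simp) he

theorem WorkZero.ctrlEvolution_mulVec {v : Ket (Fin n ⊕ (Fin m ⊕ Fin w))} (hv : WorkZero v)
    (e : Op (Fin n)) (k : Fin m) : WorkZero (ctrlEvolution w e k *ᵥ v) :=
  hv.ctrlOp_mulVec (hv.liftOp_mulVec Sum.inl_injective (by simp) e) _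

/-- The error bound for a fast-forwarding circuit carries over to its controlled version, with the
same constant, as long as the work qubits start in the state `|0⟩`. -/
theorem ketNorm_ctrlApprox_sub_ctrlEvolution_le {c : ℕ} (hc : c ≤ w) {u : Op (Fin n ⊕ Fin c)}
    {e : Op (Fin n)} {α : ℝ} (hα : 0 ≤ α)
    (h : ∀ ψ : Ket (Fin n), ketNorm ψ = 1 →
      ketNorm ((tensorOp e 1 - u) *ᵥ tensorKet ψ (ketZero (Fin c))) ≤ α)
    (k : Fin m) {v : Ket (Fin n ⊕ (Fin m ⊕ Fin w))} (hv : WorkZero v) :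
    ketNorm ((ctrlApprox hc u k - ctrlEvolution w e k) *ᵥ v) ≤ α * ketNorm v := by
  set g : Fin n ⊕ Fin c → Fin n ⊕ (Fin m ⊕ Fin w) := Sum.map id fun j => Sum.inr (Fin.castLE hc j)
    with hg
  have hginj : g.Injective := injective_sumMap_castLE hc
  have he : liftOp Sum.inl e = liftOp g (tensorOp e 1) := by
    rw [tensorOp_one_eq_liftOp, liftOp_liftOp hginj]
    rfl
  have hdiff : ketNorm (liftOp g (tensorOp e 1 - u) *ᵥ v) ≤ α * ketNorm v := by
    refine ketNorm_liftOp_mulVec_le hginj hα fun r => ?_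
    have hslice : VanishesOffZero fun p => v (Function.extend g p r) := by
      intro p j hp
      refine hv _ (Fin.castLE hc j) ?_
      rw [← hp]
      exact hginj.extend_apply p r (Sum.inr j)
    rw [hslice.eq_tensorKet]
    refine (ketNorm_mulVec_tensorKet_ketZero_le h _).trans (le_of_eq ?_)
    rw [ketNorm_tensorKet, ketNorm_ketZero, mul_one]
  refine (le_trans ?_ hdiff)
  rw [← one_mul (ketNorm (liftOp g (tensorOp e 1 - u) *ᵥ v))]
  refine ketNorm_le_of_sq_le zero_le_one ?_
  rw [one_pow, one_mul]
  refine Finset.sum_le_sum fun x _ => ?_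
  rw [Matrix.sub_mulVec, Pi.sub_apply, ctrlApprox, ctrlEvolution, ctrlOp_mulVec, ctrlOp_mulVec,
    he, liftOp_sub, Matrix.sub_mulVec, Pi.sub_apply]
  split_ifs
  · rw [norm_sub_rev]
  · rw [sub_self, norm_zero, zero_pow two_ne_zero]
    exact sq_nonneg _

/-- Errors of unitaries that are applied in succession add up, provided that the exact operators
preserve the set of vectors for which the error bounds are known. -/
theorem ketNorm_list_prod_sub_le {Q : Type} [Fintype Q] [DecidableEq Q] {κ : Type*}
    {A B : κ → Op Q} {S : Ket Q → Prop} {α : ℝ}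
    (hA : ∀ k, A k ∈ Matrix.unitaryGroup (Q → Bool) ℂ)
    (hB : ∀ k, B k ∈ Matrix.unitaryGroup (Q → Bool) ℂ)
    (hBS : ∀ k v, S v → S (B k *ᵥ v))
    (hAB : ∀ k v, S v → ketNorm ((A k - B k) *ᵥ v) ≤ α * ketNorm v) (l : List κ) {v : Ket Q}
    (hv : S v) :
    ketNorm (((l.map A).prod - (l.map B).prod) *ᵥ v) ≤ l.length * α * ketNorm v ∧
      S ((l.map B).prod *ᵥ v) := by
  induction l with
  | nil => simpa [ketNorm_zero] using hv
  | cons k l ih =>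
    obtain ⟨h1, h2⟩ := ih
    have hBl : (l.map B).prod ∈ Matrix.unitaryGroup (Q → Bool) ℂ :=
      Submonoid.list_prod_mem _ fun G hG => by
        obtain ⟨k, -, rfl⟩ := List.mem_map.1 hG
        exact hB k
    simp only [List.map_cons, List.prod_cons, List.length_cons]
    refine ⟨?_, by rw [← Matrix.mulVec_mulVec]; exact hBS k _ h2⟩
    have hsplit : (A k * (l.map A).prod - B k * (l.map B).prod) *ᵥ v =
        A k *ᵥ (((l.map A).prod - (l.map B).prod) *ᵥ v) +
          (A k - B k) *ᵥ ((l.map B).prod *ᵥ v) := by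
      rw [Matrix.mulVec_mulVec, Matrix.mulVec_mulVec, ← Matrix.add_mulVec]
      congr 1
      noncomm_ring
    rw [hsplit]
    refine (ketNorm_add_le _ _).trans ?_
    have h3 := hAB k _ h2
    rw [ketNorm_unitary_mulVec hBl] at h3
    rw [ketNorm_unitary_mulVec (hA k)]
    push_cast
    linarith

theorem ctrlEvolution_mulVec_tensorKet {e : Op (Fin n)} {ψ : Ket (Fin n)} {c : ℂ}
    (h : e *ᵥ ψ = c • ψ) (k : Fin m) (χ : Ket (Fin m)) :
    ctrlEvolution w e k *ᵥ tensorKet ψ (tensorKet χ (ketZero (Fin w))) =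
      tensorKet ψ (tensorKet (fun z => (if z k then c else 1) * χ z) (ketZero (Fin w))) := by
  funext x
  rw [ctrlEvolution, ctrlOp_mulVec, liftOp_inl_mulVec_tensorKet, h]
  simp only [tensorKet, Pi.smul_apply, smul_eq_mul]
  split_ifs <;> ring

/-- On an eigenstate, controlled evolutions only attach phases to the output register. -/
theorem list_prod_ctrlEvolution_mulVec {e : Fin m → Op (Fin n)} {ψ : Ket (Fin n)}
    {c : Fin m → ℂ} (h : ∀ k, e k *ᵥ ψ = c k • ψ) (l : List (Fin m)) (χ : Ket (Fin m)) :
    (l.map fun k => ctrlEvolution w (e k) k).prod *ᵥ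
        tensorKet ψ (tensorKet χ (ketZero (Fin w))) =
      tensorKet ψ (tensorKet (fun z => (l.map fun k => if z k then c k else 1).prod * χ z)
        (ketZero (Fin w))) := by
  induction l with
  | nil => simp
  | cons k l ih =>
    simp only [List.map_cons, List.prod_cons]
    rw [← Matrix.mulVec_mulVec, ih, ctrlEvolution_mulVec_tensorKet (h k)]
    simp only [mul_assoc]

theorem IsPremeasurement.mono {H : Op (Fin n)} {f : ℕ} {U : Op (Fin n ⊕ (Fin (m + 1) ⊕ Fin w))}
    {η η' δ : ℝ} (h : IsPremeasurement H f U η δ) (hη : η' ≤ η) :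
    IsPremeasurement H f U η' δ := by
  intro ψ E hψ hE
  obtain ⟨a, g, hg, hU, ha⟩ := h ψ E hψ hE
  exact ⟨a, g, hg, hU, hη.trans ha⟩

/-- Phase estimation on `m + 1` output qubits, using approximations of the evolutions for the
times `2^j π / 2`. The energies lie in `[-1, 1]`, so that the phases `E / 4` of the basic evolution
are determined modulo integers; the signed binary numbers with `m - 1` digits after the point are
precisely the multiples of `2^{1-m}` in `[-2, 2)`. -/
theorem exists_premeasurement {H : Op (Fin n)} (hH : H.IsHermitian) (hH1 : ‖H‖ = 1) (hm : 1 ≤ m)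
    {α : ℝ} (hα : 0 ≤ α) {s : ℕ}
    (hff : ∀ k : Fin (m + 1), ∃ c ≤ w, ∃ u : Op (Fin n ⊕ Fin c), HasCircuit u s ∧
      ∀ ψ : Ket (Fin n), ketNorm ψ = 1 →
        ketNorm ((tensorOp (evolution H (2 ^ (m - k : ℕ) * (Real.pi / 2))) 1 - u) *ᵥ
          tensorKet ψ (ketZero (Fin c))) ≤ α)
    (hsmall : 5 * ((m + 1 : ℕ) * α) < 1) {δ : ℝ} (hδ : 0 < δ) :
    ∃ U U' : Op (Fin n ⊕ (Fin (m + 1) ⊕ Fin w)),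
      U ∈ Matrix.unitaryGroup (Fin n ⊕ (Fin (m + 1) ⊕ Fin w) → Bool) ℂ ∧
      IsPremeasurement H (m - 1) U (1 - 36 / (2 ^ (m + 1) * δ ^ 2)) δ ∧
      HasCircuit U' (2 * (m + 1) ^ 2 + 7 * (m + 1) * s) ∧
      ‖U - U'‖ ≤ 7 * ((m + 1 : ℕ) * α) := by
  choose c hc u hu happrox using hff
  set e : Fin (m + 1) → Op (Fin n) := fun k => evolution H (2 ^ (m - k : ℕ) * (Real.pi / 2)) with he
  have heu : ∀ k, e k ∈ Matrix.unitaryGroup (Fin n → Bool) ℂ := fun k => evolution_mem_unitary hH _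
  -- The first Fourier transform only serves to turn `|0⋯0⟩` into the uniform superposition.
  set F : Op (Fin n ⊕ (Fin (m + 1) ⊕ Fin w)) :=
    liftOp (Sum.inr ∘ Sum.inl) (fourierStages (m + 1) (m + 1)) with hF
  have hFinj : Function.Injective
      (Sum.inr ∘ Sum.inl : Fin (m + 1) → Fin n ⊕ (Fin (m + 1) ⊕ Fin w)) :=
    Sum.inr_injective.comp Sum.inl_injective
  have hFcirc : HasCircuit F ((m + 1) * (m + 1)) :=
    (hasCircuit_fourierStages (m + 1) le_rfl).liftOp hFinj
  have hFu := hFcirc.mem_unitary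
  set A : Fin (m + 1) → Op (Fin n ⊕ (Fin (m + 1) ⊕ Fin w)) := fun k => ctrlApprox (hc k) (u k) k
    with hA
  set B : Fin (m + 1) → Op (Fin n ⊕ (Fin (m + 1) ⊕ Fin w)) := fun k => ctrlEvolution w (e k) k
    with hB
  set l := List.finRange (m + 1) with hl
  have hAcirc : ∀ k, HasCircuit (A k) (7 * s) := fun k => (hu k).ctrlApprox (hc k) k
  have hAlist : ∀ l : List (Fin (m + 1)), HasCircuit (l.map A).prod (l.length * (7 * s)) := by
    intro l
    induction l with
    | nil => simpa using HasCircuit.one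
    | cons k l ih =>
      simp only [List.map_cons, List.prod_cons, List.length_cons]
      exact ((hAcirc k).mul ih).mono (by rw [add_mul, one_mul, add_comm])
  have hBu : ∀ k, B k ∈ Matrix.unitaryGroup _ ℂ := fun k => ctrlEvolution_mem_unitary (heu k) k
  set U' := F * (l.map A).prod * F with hU'
  set V := F * (l.map B).prod * F with hV
  have hU'circ : HasCircuit U' (2 * (m + 1) ^ 2 + 7 * (m + 1) * s) := by
    refine ((hFcirc.mul (hAlist l)).mul hFcirc).mono (le_of_eq ?_)
    rw [hl, List.length_finRange]
    ring
  have hVu : V ∈ Matrix.unitaryGroup _ ℂ := by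
    refine mul_mem (mul_mem hFu (Submonoid.list_prod_mem _ fun G hG => ?_)) hFu
    obtain ⟨k, -, rfl⟩ := List.mem_map.1 hG
    exact hBu k
  set P : Op (Fin n ⊕ (Fin (m + 1) ⊕ Fin w)) :=
    Matrix.diagonal fun x => if ∀ j, x (Sum.inr j) = false then 1 else 0 with hP
  have hPstar : star P = P := by
    rw [hP, Matrix.star_eq_conjTranspose, Matrix.diagonal_conjTranspose]
    congr 1
    funext x
    simp only [Pi.star_apply, apply_ite star, star_one, star_zero]
  have hPP : P * P = P := by
    rw [hP, Matrix.diagonal_mul_diagonal]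
    congr 1
    funext x
    split_ifs <;> simp
  have hclose : ‖(U' - V) * P‖ ≤ (m + 1 : ℕ) * α := by
    refine norm_le_of_ketNorm_mulVec_le (by positivity) fun v => ?_
    have hPv : WorkZero (P *ᵥ v) := by
      intro x j hx
      rw [hP, Matrix.mulVec_diagonal, if_neg (fun h => by simp [h] at hx), zero_mul]
    have hFPv : WorkZero (F *ᵥ (P *ᵥ v)) := hPv.liftOp_mulVec hFinj (by simp) _
    have h1 := (ketNorm_list_prod_sub_le (S := WorkZero) (α := α)
      (fun k => (hAcirc k).mem_unitary) hBu (fun k v hv => hv.ctrlEvolution_mulVec (e k) k)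
      (fun k v hv => ketNorm_ctrlApprox_sub_ctrlEvolution_le (hc k) hα (happrox k) k hv)
      l hFPv).1
    have h2 : ((U' - V) * P) *ᵥ v =
        F *ᵥ (((l.map A).prod - (l.map B).prod) *ᵥ (F *ᵥ (P *ᵥ v))) := by
      simp only [Matrix.mulVec_mulVec]
      congr 1
      rw [hU', hV]
      noncomm_ring
    rw [h2, ketNorm_unitary_mulVec hFu]
    refine h1.trans ?_
    rw [ketNorm_unitary_mulVec hFu, hl, List.length_finRange]
    refine mul_le_mul_of_nonneg_left ?_ (by positivity)
    exact (ketNorm_mulVec_le P v).trans (mul_le_of_le_one_left (ketNorm_nonneg v)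
      (norm_le_one_of_projection hPstar hPP))
  obtain ⟨U, hUu, hUP, hUU'⟩ :=
    exists_unitary_eq_on_projection hU'circ.mem_unitary hVu hPstar hPP hclose hsmall
  refine ⟨U, U', hUu, ?_, hU'circ, hUU'⟩
  intro ψ E hψ hE
  set v := tensorKet ψ (tensorKet (ketZero (Fin (m + 1))) (ketZero (Fin w))) with hv
  have hPv : P *ᵥ v = v := by
    funext x
    rw [hP, Matrix.mulVec_diagonal]
    split_ifs with h
    · rw [one_mul]
    · push Not at h
      obtain ⟨j, hj⟩ := h
      have hzero : v x = 0 := by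
        rw [hv]
        simp only [tensorKet, ketZero, ket]
        rcases j with j | j
        · rw [Pi.single_eq_of_ne (fun h => hj (congrFun h j)), zero_mul, mul_zero]
        · rw [Pi.single_eq_of_ne (i := fun _ => false) (fun h => hj (congrFun h j)), mul_zero,
            mul_zero]
      rw [hzero, mul_zero]
  have hFv : ∀ χ : Ket (Fin (m + 1)), F *ᵥ tensorKet ψ (tensorKet χ (ketZero (Fin w))) =
      tensorKet ψ (tensorKet (fourierStages (m + 1) (m + 1) *ᵥ χ) (ketZero (Fin w))) := by
    intro χ
    rw [hF, ← liftOp_liftOp Sum.inr_injective, liftOp_inr_mulVec_tensorKet,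
      liftOp_inl_mulVec_tensorKet]
  have hVv : V *ᵥ v = tensorKet ψ (tensorKet (estimateAmplitude E) (ketZero (Fin w))) := by
    rw [hV, ← Matrix.mulVec_mulVec, ← Matrix.mulVec_mulVec, hv, hFv, hB,
      list_prod_ctrlEvolution_mulVec fun k => evolution_mulVec_of_eigenvector hE _, hFv]
    simp only [hl, ← List.ofFn_eq_map, List.prod_ofFn]
    rw [fourier_mulVec_phases hm E _ fun k => rfl]
  have hUv : U *ᵥ v = tensorKet ψ (tensorKet (estimateAmplitude E) (ketZero (Fin w))) := by
    rw [← hVv, ← hPv, Matrix.mulVec_mulVec, Matrix.mulVec_mulVec, hUP]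
  refine ⟨estimateAmplitude E, fun _ => ketZero (Fin w), fun _ => ketNorm_ketZero, ?_, ?_⟩
  · rw [sum_smul_tensorKet_ket]
    exact hUv
  · refine one_sub_le_sum_estimateAmplitude hm (abs_eigenvalue_le hH1 hψ hE) hδ ?_
    have h1 := congrArg ketNorm hUv
    rw [ketNorm_unitary_mulVec hUu, hv] at h1
    simp only [ketNorm_tensorKet, ketNorm_ketZero, hψ, mul_one, one_mul] at h1
    rw [← ketNorm_sq, ← h1, one_pow]

end PhaseEstimation

/-! ### Fast forwarding with an energy measurement -/

section Measurement

theorem norm_exp_sub_exp_le (a b : ℝ) :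
    ‖Complex.exp (a * Complex.I) - Complex.exp (b * Complex.I)‖ ≤ |a - b| := by
  have h : Complex.exp (a * Complex.I) - Complex.exp (b * Complex.I) =
      Complex.exp (b * Complex.I) * (Complex.exp (Complex.I * ((a - b : ℝ) : ℂ)) - 1) := by
    rw [mul_sub, mul_one, ← Complex.exp_add]
    congr 2
    push_cast
    ring
  rw [h, norm_mul, Complex.norm_exp_ofReal_mul_I, one_mul]
  exact Real.norm_exp_I_mul_ofReal_sub_one_le

theorem norm_exp_sub_exp_le_two (a b : ℝ) :
    ‖Complex.exp (a * Complex.I) - Complex.exp (b * Complex.I)‖ ≤ 2 := by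
  refine (norm_sub_le _ _).trans ?_
  rw [Complex.norm_exp_ofReal_mul_I, Complex.norm_exp_ofReal_mul_I]
  norm_num

open Classical in
/-- Replacing the outcome `E'` of a measurement by the energy `E` in the phase `e^{-iE't}` causes an
error of at most `δ t` if `|E - E'| ≤ δ`, and of at most `2` otherwise. -/
theorem sum_phase_error_le {κ : Type*} [Fintype κ] {p out : κ → ℝ} {E t η δ : ℝ}
    (hp : ∀ x, 0 ≤ p x) (hsum : ∑ x, p x = 1) (ht : 0 ≤ t)
    (hη : η ≤ ∑ x with |E - out x| ≤ δ, p x) :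
    ∑ x, ‖Complex.exp ((-(E * t) : ℝ) * Complex.I) -
        Complex.exp ((-(out x * t) : ℝ) * Complex.I)‖ ^ 2 * p x ≤ (δ * t) ^ 2 + 4 * (1 - η) := by
  rw [← Finset.sum_filter_add_sum_filter_not _ fun x => |E - out x| ≤ δ] at hsum ⊢
  refine add_le_add ?_ ?_
  · have h1 : ∀ x ∈ Finset.univ.filter (fun x => |E - out x| ≤ δ),
        ‖Complex.exp ((-(E * t) : ℝ) * Complex.I) -
          Complex.exp ((-(out x * t) : ℝ) * Complex.I)‖ ^ 2 * p x ≤ (δ * t) ^ 2 * p x := by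
      intro x hx
      refine mul_le_mul_of_nonneg_right (pow_le_pow_left₀ (norm_nonneg _) ?_ 2) (hp x)
      refine (norm_exp_sub_exp_le _ _).trans ?_
      rw [show -(E * t) - -(out x * t) = -((E - out x) * t) by ring, abs_neg, abs_mul,
        abs_of_nonneg ht]
      exact mul_le_mul_of_nonneg_right (by simpa using hx) ht
    refine (Finset.sum_le_sum h1).trans ?_
    rw [← Finset.mul_sum]
    refine mul_le_of_le_one_right (sq_nonneg _) ?_
    have := Finset.sum_nonneg fun x (_ : x ∈ Finset.univ.filter fun x => ¬ |E - out x| ≤ δ) => hp x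
    linarith
  · have h1 : ∀ x ∈ Finset.univ.filter (fun x => ¬ |E - out x| ≤ δ),
        ‖Complex.exp ((-(E * t) : ℝ) * Complex.I) -
          Complex.exp ((-(out x * t) : ℝ) * Complex.I)‖ ^ 2 * p x ≤ 4 * p x := by
      intro x _
      refine mul_le_mul_of_nonneg_right ?_ (hp x)
      have := pow_le_pow_left₀ (norm_nonneg _)
        (norm_exp_sub_exp_le_two (-(E * t)) (-(out x * t))) 2
      linarith
    refine (Finset.sum_le_sum h1).trans ?_
    rw [← Finset.mul_sum]
    linarith

variable {n m w : ℕ}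

/-- The operator `e^{-iE't}`, where `E'` is the number denoted by the output register. -/
noncomputable def outcomePhase (m f : ℕ) (t : ℝ) : Op (Fin (m + 1)) :=
  Matrix.diagonal fun x => Complex.exp ((-(outcome f x * t) : ℝ) * Complex.I)

theorem hasCircuit_outcomePhase (m f : ℕ) (t : ℝ) : HasCircuit (outcomePhase m f t) (m + 1) := by
  have h : outcomePhase m f t = Matrix.diagonal fun x : Fin (m + 1) → Bool =>
      ∏ j, if x j then Complex.exp ((-(outcomeWeight m f j * t) : ℝ) * Complex.I) else 1 := by
    rw [outcomePhase]
    congr 1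
    funext x
    have h1 : ((-(outcome f x * t) : ℝ) : ℂ) * Complex.I =
        ∑ j, if x j then ((-(outcomeWeight m f j * t) : ℝ) : ℂ) * Complex.I else 0 := by
      rw [outcome_eq_sum, Finset.sum_mul, ← Finset.sum_neg_distrib, Complex.ofReal_sum,
        Finset.sum_mul]
      refine Finset.sum_congr rfl fun j _ => ?_
      split_ifs <;> simp
    rw [h1, Complex.exp_sum]
    refine Finset.prod_congr rfl fun j _ => ?_
    rw [apply_ite Complex.exp, Complex.exp_zero]
  have hcirc := hasCircuit_diagonal_prod (Finset.univ : Finset (Fin (m + 1)))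
    (fun j x => if x j then Complex.exp ((-(outcomeWeight m f j * t) : ℝ) * Complex.I) else 1)
    fun j _ => by
      refine isGate_diagonal (fun x => ?_) {j} (by simp) fun x y hxy => ?_
      · split_ifs
        · exact Complex.norm_exp_ofReal_mul_I _
        · simp
      · rw [hxy j (by simp)]
  rw [h]
  simpa using hcirc

/-- For an orthonormal basis `b`, the vectors `b j ⊗ χ j` are orthogonal. -/
theorem ketNorm_sum_tensorKet_sq {P Q : Type} [Fintype P] [DecidableEq P] [Fintype Q]
    [DecidableEq Q] {κ : Type*} [Fintype κ]
    (b : OrthonormalBasis κ ℂ (EuclideanSpace ℂ (P → Bool))) (χ : κ → Ket Q) :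
    ketNorm (∑ j, tensorKet (WithLp.ofLp (b j)) (χ j)) ^ 2 = ∑ j, ketNorm (χ j) ^ 2 := by
  simp only [ketNorm_sq]
  rw [sum_sum_register, Finset.sum_comm, Finset.sum_comm (s := (Finset.univ : Finset κ))]
  refine Finset.sum_congr rfl fun y _ => ?_
  have h1 : ketNorm (WithLp.ofLp (b.repr.symm (WithLp.toLp 2 fun j => χ j y))) ^ 2 =
      ∑ j, ‖χ j y‖ ^ 2 := by
    have h2 : ketNorm (WithLp.ofLp (b.repr.symm (WithLp.toLp 2 fun j => χ j y))) =
        ‖b.repr.symm (WithLp.toLp 2 fun j => χ j y)‖ := rfl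
    rw [h2, LinearIsometryEquiv.norm_map, EuclideanSpace.norm_sq_eq]
  rw [← h1, ketNorm_sq, ← b.sum_repr_symm]
  refine Finset.sum_congr rfl fun s _ => ?_
  simp [tensorKet, Finset.sum_apply, mul_comm]

/-- If `U` premeasures the energy of `H`, then `U† e^{-iE't} U` approximates the evolution
`e^{-iHt}`. -/
theorem ketNorm_evolution_sub_le {H : Op (Fin n)} (hH : H.IsHermitian) {f : ℕ}
    {U : Op (Fin n ⊕ (Fin (m + 1) ⊕ Fin w))} {η δ t : ℝ}
    (hU : U ∈ Matrix.unitaryGroup (Fin n ⊕ (Fin (m + 1) ⊕ Fin w) → Bool) ℂ)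
    (hmeas : IsPremeasurement H f U η δ) (ht : 0 ≤ t) {ψ : Ket (Fin n)} (hψ : ketNorm ψ = 1) :
    ketNorm ((liftOp Sum.inl (evolution H t) -
      star U * liftOp (Sum.inr ∘ Sum.inl) (outcomePhase m f t) * U) *ᵥ
        tensorKet ψ (tensorKet (ketZero (Fin (m + 1))) (ketZero (Fin w)))) ≤
      Real.sqrt ((δ * t) ^ 2 + 4 * (1 - η)) := by
  classical
  set ζ := tensorKet (ketZero (Fin (m + 1))) (ketZero (Fin w)) with hζ
  have hζ1 : ketNorm ζ = 1 := by
    rw [hζ, ketNorm_tensorKet, ketNorm_ketZero, ketNorm_ketZero, one_mul]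
  set b := hH.eigenvectorBasis with hb
  set E := hH.eigenvalues with hE
  have hbE : ∀ j, H *ᵥ WithLp.ofLp (b j) = (E j : ℂ) • WithLp.ofLp (b j) := by
    intro j
    rw [hH.mulVec_eigenvectorBasis j]
    funext x
    simp [hb, hE]
  have hb1 : ∀ j, ketNorm (WithLp.ofLp (b j)) = 1 := fun j => b.orthonormal.1 j
  choose a g hg hUb ha using fun j => hmeas (WithLp.ofLp (b j)) (E j) (hb1 j) (hbE j)
  set φ : (Fin n → Bool) → Ket (Fin (m + 1) ⊕ Fin w) :=
    fun j => ∑ x, a j x • tensorKet (ket x) (g j x) with hφ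
  have hφapply : ∀ j x y, φ j (Sum.elim x y) = a j x * g j x y := by
    intro j x y
    simp [hφ, tensorKet, ket, Finset.sum_apply, Pi.single_apply]
  have hsum : ∀ j (r : (Fin (m + 1) → Bool) → ℝ),
      ∑ z, r (z ∘ Sum.inl) * ‖φ j z‖ ^ 2 = ∑ x, r x * ‖a j x‖ ^ 2 := by
    intro j r
    rw [sum_sum_register]
    refine Finset.sum_congr rfl fun x _ => ?_
    have h1 : ∀ y : Fin w → Bool, r (Sum.elim x y ∘ Sum.inl) * ‖φ j (Sum.elim x y)‖ ^ 2 =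
        r x * ‖a j x‖ ^ 2 * ‖g j x y‖ ^ 2 := by
      intro y
      rw [hφapply, norm_mul, mul_pow, mul_assoc]
      rfl
    simp only [h1]
    rw [← Finset.mul_sum, ← ketNorm_sq, hg, one_pow, mul_one]
  have ha1 : ∀ j, ∑ x, ‖a j x‖ ^ 2 = 1 := by
    intro j
    have h1 : ketNorm (U *ᵥ tensorKet (WithLp.ofLp (b j)) ζ) =
        ketNorm (tensorKet (WithLp.ofLp (b j)) (φ j)) := congrArg ketNorm (hUb j)
    rw [ketNorm_unitary_mulVec hU, ketNorm_tensorKet _ ζ, ketNorm_tensorKet _ (φ j), hb1, one_mul,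
      one_mul, hζ1] at h1
    have h2 := hsum j fun _ => 1
    simp only [one_mul] at h2
    rw [← h2, ← ketNorm_sq, ← h1, one_pow]
  -- `c` holds the coordinates of `ψ` in the eigenbasis.
  set c : (Fin n → Bool) → ℂ := fun j => b.repr (WithLp.toLp 2 ψ) j with hc
  have hψc : ψ = ∑ j, c j • WithLp.ofLp (b j) := by
    have h1 := congrArg WithLp.ofLp (b.sum_repr (WithLp.toLp 2 ψ))
    simpa using h1.symm
  have hc1 : ∑ j, ‖c j‖ ^ 2 = 1 := by
    have h1 : ‖b.repr (WithLp.toLp 2 ψ)‖ = 1 := by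
      rw [LinearIsometryEquiv.norm_map]
      exact hψ
    rw [← EuclideanSpace.norm_sq_eq, h1, one_pow]
  set D : Op (Fin n ⊕ (Fin (m + 1) ⊕ Fin w)) :=
    liftOp (Sum.inr ∘ Sum.inl) (outcomePhase m f t) with hD
  set ν : (Fin n → Bool) → Ket (Fin (m + 1) ⊕ Fin w) := fun j z =>
    c j * ((Complex.exp ((-(E j * t) : ℝ) * Complex.I) -
      Complex.exp ((-(outcome f (z ∘ Sum.inl) * t) : ℝ) * Complex.I)) * φ j z) with hν
  have hmain : ketNorm ((liftOp Sum.inl (evolution H t) - star U * D * U) *ᵥ tensorKet ψ ζ) =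
      ketNorm (∑ j, tensorKet (WithLp.ofLp (b j)) (ν j)) := by
    rw [← ketNorm_unitary_mulVec hU]
    congr 1
    have hlin : ∀ A : Op (Fin n ⊕ (Fin (m + 1) ⊕ Fin w)), A *ᵥ tensorKet ψ ζ =
        ∑ j, c j • (A *ᵥ tensorKet (WithLp.ofLp (b j)) ζ) := by
      intro A
      have h1 : tensorKet ψ ζ = ∑ j, c j • tensorKet (WithLp.ofLp (b j)) ζ := by
        conv_lhs => rw [hψc]
        funext x
        simp [tensorKet, Finset.sum_apply, Finset.sum_mul, mul_assoc]
      rw [h1, Matrix.mulVec_sum]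
      simp only [Matrix.mulVec_smul]
    rw [Matrix.mulVec_mulVec, mul_sub, ← mul_assoc U, ← mul_assoc U,
      Unitary.mul_star_self_of_mem hU, one_mul, hlin]
    refine Finset.sum_congr rfl fun j _ => ?_
    rw [Matrix.sub_mulVec, ← Matrix.mulVec_mulVec, ← Matrix.mulVec_mulVec,
      liftOp_inl_mulVec_tensorKet, evolution_mulVec_of_eigenvector (hbE j), tensorKet_smul_left,
      Matrix.mulVec_smul, hUb, hD, ← liftOp_liftOp Sum.inr_injective, liftOp_inr_mulVec_tensorKet,
      outcomePhase, liftOp_diagonal]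
    funext x
    simp only [Pi.smul_apply, Pi.sub_apply, smul_eq_mul, tensorKet, Matrix.mulVec_diagonal, hν, hφ]
    ring
  rw [hmain]
  refine Real.le_sqrt_of_sq_le ?_
  rw [ketNorm_sum_tensorKet_sq]
  have hterm : ∀ j, ketNorm (ν j) ^ 2 ≤ ‖c j‖ ^ 2 * ((δ * t) ^ 2 + 4 * (1 - η)) := by
    intro j
    have h1 : ketNorm (ν j) ^ 2 = ‖c j‖ ^ 2 * ∑ x, ‖Complex.exp ((-(E j * t) : ℝ) * Complex.I) -
        Complex.exp ((-(outcome f x * t) : ℝ) * Complex.I)‖ ^ 2 * ‖a j x‖ ^ 2 := by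
      rw [← hsum j fun x => ‖Complex.exp ((-(E j * t) : ℝ) * Complex.I) -
        Complex.exp ((-(outcome f x * t) : ℝ) * Complex.I)‖ ^ 2, ketNorm_sq, Finset.mul_sum]
      simp only [hν, norm_mul, mul_pow]
    rw [h1]
    exact mul_le_mul_of_nonneg_left
      (sum_phase_error_le (fun x => sq_nonneg _) (ha1 j) ht (ha j)) (sq_nonneg _)
  refine (Finset.sum_le_sum fun j _ => hterm j).trans (le_of_eq ?_)
  rw [← Finset.sum_mul, hc1, one_mul]

/-- Fast forwarding by a circuit `U'` that is close to a premeasurement `U` of the energy. -/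
theorem exists_fastForward {H : Op (Fin n)} (hH : H.IsHermitian) {f : ℕ}
    {U U' : Op (Fin n ⊕ (Fin (m + 1) ⊕ Fin w))} {η δ β t : ℝ} {s : ℕ}
    (hU : U ∈ Matrix.unitaryGroup (Fin n ⊕ (Fin (m + 1) ⊕ Fin w) → Bool) ℂ)
    (hmeas : IsPremeasurement H f U η δ) (hU' : HasCircuit U' s) (hUU' : ‖U - U'‖ ≤ β)
    (ht : 0 ≤ t) :
    ∃ Z : Op (Fin n ⊕ Fin (m + 1 + w)), HasCircuit Z (2 * s + (m + 1)) ∧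
      ∀ ψ : Ket (Fin n), ketNorm ψ = 1 →
        ketNorm ((tensorOp (evolution H t) 1 - Z) *ᵥ tensorKet ψ (ketZero (Fin (m + 1 + w)))) ≤
          Real.sqrt ((δ * t) ^ 2 + 4 * (1 - η)) + 2 * β := by
  set D : Op (Fin n ⊕ (Fin (m + 1) ⊕ Fin w)) :=
    liftOp (Sum.inr ∘ Sum.inl) (outcomePhase m f t) with hD
  have hDcirc : HasCircuit D (m + 1) :=
    (hasCircuit_outcomePhase m f t).liftOp (Sum.inr_injective.comp Sum.inl_injective)
  set g : Fin n ⊕ (Fin (m + 1) ⊕ Fin w) → Fin n ⊕ Fin (m + 1 + w) :=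
    Sum.map id finSumFinEquiv with hg
  have hginj : g.Injective :=
    Sum.map_injective.2 ⟨Function.injective_id, finSumFinEquiv.injective⟩
  have hgsurj : ∀ q, ∃ p, g p = q := by
    rintro (i | j)
    · exact ⟨Sum.inl i, rfl⟩
    · exact ⟨Sum.inr (finSumFinEquiv.symm j), by simp [hg]⟩
  refine ⟨liftOp g (star U' * D * U'),
    (((hU'.star.mul hDcirc).mul hU').liftOp hginj).mono (by omega), fun ψ hψ => ?_⟩
  set K := Real.sqrt ((δ * t) ^ 2 + 4 * (1 - η)) with hK
  have hβ : 0 ≤ β := (norm_nonneg _).trans hUU'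
  have hev : tensorOp (evolution H t) (1 : Op (Fin (m + 1 + w))) =
      liftOp g (liftOp Sum.inl (evolution H t)) := by
    rw [tensorOp_one_eq_liftOp, liftOp_liftOp hginj]
    rfl
  have hnorm1 : ketNorm (tensorKet ψ (ketZero (Fin (m + 1 + w)))) = 1 := by
    rw [ketNorm_tensorKet, hψ, ketNorm_ketZero, one_mul]
  have hslice : ∀ r : Fin n ⊕ Fin (m + 1 + w) → Bool,
      (fun p => tensorKet ψ (ketZero (Fin (m + 1 + w))) (Function.extend g p r)) =
        tensorKet ψ (tensorKet (ketZero (Fin (m + 1))) (ketZero (Fin w))) := by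
    intro r
    funext p
    have hinl : (fun i => Function.extend g p r (Sum.inl i)) = fun i => p (Sum.inl i) :=
      funext fun i => hginj.extend_apply p r (Sum.inl i)
    have hinr : ∀ j, Function.extend g p r (Sum.inr (finSumFinEquiv j)) = p (Sum.inr j) :=
      fun j => hginj.extend_apply p r (Sum.inr j)
    have hiff : ((fun i => Function.extend g p r (Sum.inr i)) = fun _ => false) ↔
        (((fun i => p (Sum.inr (Sum.inl i))) = fun _ => false) ∧
          (fun i => p (Sum.inr (Sum.inr i))) = fun _ => false) := by
      simp only [funext_iff, ← hinr]
      rw [← finSumFinEquiv.forall_congr_right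
        (q := fun i => Function.extend g p r (Sum.inr i) = false), Sum.forall]
    simp only [tensorKet, ketZero, ket, Pi.single_apply, hinl, hiff]
    split_ifs <;> simp_all
  have hswap : ‖star U * D * U - star U' * D * U'‖ ≤ 2 * β := by
    have h1 : star U * D * U - star U' * D * U' =
        star (U - U') * (D * U) + star U' * D * (U - U') := by
      rw [star_sub]
      noncomm_ring
    have hDu := hDcirc.mem_unitary
    rw [h1, two_mul]
    refine (norm_add_le _ _).trans (add_le_add ?_ ?_)
    · rw [norm_mul_unitary (mul_mem hDu hU), norm_star]
      exact hUU'
    · rw [norm_unitary_mul (mul_mem (Unitary.star_mem hU'.mem_unitary) hDu)]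
      exact hUU'
  rw [hev, ← liftOp_sub, ← mul_one (K + 2 * β), ← hnorm1]
  refine ketNorm_liftOp_mulVec_le hginj (by positivity) fun r => ?_
  simp only [hslice]
  set v := tensorKet ψ (tensorKet (ketZero (Fin (m + 1))) (ketZero (Fin w))) with hv
  have hv1 : ketNorm v = 1 := by
    rw [hv]
    simp only [ketNorm_tensorKet, ketNorm_ketZero, hψ, mul_one]
  have hsplit : liftOp Sum.inl (evolution H t) - star U' * D * U' =
      (liftOp Sum.inl (evolution H t) - star U * D * U) +
        (star U * D * U - star U' * D * U') := by abel
  rw [hsplit, Matrix.add_mulVec, hv1, mul_one]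
  refine (ketNorm_add_le _ _).trans (add_le_add (ketNorm_evolution_sub_le hH hU hmeas ht hψ) ?_)
  refine (ketNorm_mulVec_le _ v).trans ?_
  rwa [hv1, mul_one]

end Measurement

/-! ### Asymptotics -/

section Asymptotics

open Filter

theorem eventually_eval_le_rpow (p : Polynomial ℕ) {c : ℝ} (hc : 0 < c) :
    ∀ᶠ n : ℕ in atTop, ((p.eval n : ℕ) : ℝ) ≤ (2 : ℝ) ^ (c * n) := by
  have h1 : (1 : ℝ) < 2 ^ c := Real.one_lt_rpow (by norm_num) hc
  have h2 : (fun n : ℕ => ((p.eval n : ℕ) : ℝ)) =o[atTop] fun n : ℕ => ((2 : ℝ) ^ c) ^ n := by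
    have h3 : (fun n : ℕ => ((p.eval n : ℕ) : ℝ)) =
        fun n : ℕ => ∑ i ∈ Finset.range (p.natDegree + 1), (p.coeff i : ℝ) * (n : ℝ) ^ i := by
      funext n
      rw [Polynomial.eval_eq_sum_range]
      push_cast
      rfl
    rw [h3]
    refine Asymptotics.IsLittleO.fun_sum fun i _ => ?_
    exact (isLittleO_pow_const_const_pow_of_one_lt i h1).const_mul_left _
  filter_upwards [h2.bound one_pos] with n hn
  rw [one_mul, Real.norm_of_nonneg (Nat.cast_nonneg _), Real.norm_of_nonneg (by positivity)] at hn
  rwa [Real.rpow_mul (by norm_num), Real.rpow_natCast]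

theorem one_le_eval {p : Polynomial ℕ} (hp : p ≠ 0) {n : ℕ} (hn : 1 ≤ n) : 1 ≤ p.eval n := by
  have h1 : p.leadingCoeff ≠ 0 := Polynomial.leadingCoeff_ne_zero.2 hp
  rw [Polynomial.eval_eq_sum_range]
  refine le_trans ?_ (Finset.single_le_sum (f := fun i => p.coeff i * n ^ i)
    (fun i _ => Nat.zero_le _) (Finset.mem_range.2 (Nat.lt_succ_self p.natDegree)))
  exact Nat.mul_pos (Nat.pos_of_ne_zero h1) (pow_pos hn _)

theorem isInvPoly_one_div_eval {p : Polynomial ℕ} (hp : p ≠ 0) :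
    IsInvPoly fun n => 1 / ((p.eval n : ℕ) : ℝ) :=
  ⟨p, hp, Eventually.of_forall fun _ => le_rfl⟩

/-- Phase estimation for times up to `2^{cn}` with accuracy `2^{-cn/3}`. The accuracy is far coarser
than the resolution of the output register, which makes the failure probability exponentially
small without any amplification. -/
theorem mem_SEEMexp_of_mem_FFexp {H : HamiltonianFamily} (hH : H ∈ FFexp) : H ∈ SEEMexp := by
  obtain ⟨T, ⟨c₀, hc₀, hT⟩, hff⟩ := hH
  -- A rate of at most `1` ensures that there are at most `n` output qubits.
  obtain ⟨c, hc, hc1, hcc₀⟩ : ∃ c : ℝ, 0 < c ∧ c ≤ 1 ∧ c ≤ c₀ :=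
    ⟨min c₀ 1, lt_min hc₀ one_pos, min_le_right _ _, min_le_left _ _⟩
  refine ⟨fun n => (2 : ℝ) ^ (-(c / 3 * n)), ⟨c / 3, by positivity,
    Eventually.of_forall fun n => le_rfl⟩, fun η β hη hβ => ?_⟩
  obtain ⟨q, hq0, hq⟩ := hη
  obtain ⟨r, hr0, hr⟩ := hβ
  have hr8 : 8 * Polynomial.X * r ≠ 0 :=
    mul_ne_zero (mul_ne_zero (by norm_num) Polynomial.X_ne_zero) hr0
  obtain ⟨p, hp⟩ := hff _ (isInvPoly_one_div_eval hr8)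
  refine ⟨2 * Polynomial.X ^ 2 + 7 * Polynomial.X * p + Polynomial.X + p, ?_⟩
  have hlarge : ∀ᶠ n : ℕ in atTop, 2 ≤ c * n :=
    (tendsto_natCast_atTop_atTop.const_mul_atTop hc).eventually_ge_atTop 2
  filter_upwards [hp, hT, hq, hr, hlarge, eventually_ge_atTop 1,
    eventually_eval_le_rpow (72 * q) (c := c / 3) (by positivity)] with n hpn hTn hqn hrn hcn hn hqexp
  obtain ⟨m, hmfloor⟩ : ∃ m, ⌊c * n⌋₊ = m + 1 :=
    ⟨⌊c * n⌋₊ - 1, (Nat.sub_add_cancel (Nat.le_floor (by norm_num; linarith))).symm⟩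
  have hm : 1 ≤ m := by
    have : 2 ≤ ⌊c * n⌋₊ := Nat.le_floor (by exact_mod_cast hcn)
    omega
  have hmle : ((m + 1 : ℕ) : ℝ) ≤ c * n := hmfloor ▸ Nat.floor_le (by positivity)
  have hmge : c * n - 1 ≤ ((m + 1 : ℕ) : ℝ) := hmfloor ▸ (Nat.sub_one_lt_floor _).le
  have hn0 : (1 : ℝ) ≤ n := by exact_mod_cast hn
  have hmn : m + 1 ≤ n := by
    have : ((m + 1 : ℕ) : ℝ) ≤ n := by nlinarith
    exact_mod_cast this
  have hTm : (2 : ℝ) ^ (m + 1) ≤ T n := by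
    refine le_trans ?_ hTn
    rw [← Real.rpow_natCast]
    refine Real.rpow_le_rpow_of_exponent_le (by norm_num) (hmle.trans ?_)
    exact mul_le_mul_of_nonneg_right hcc₀ (by positivity)
  set α : ℝ := 1 / (((8 * Polynomial.X * r).eval n : ℕ) : ℝ) with hα
  have hr1 : (1 : ℝ) ≤ (r.eval n : ℕ) := by exact_mod_cast one_le_eval hr0 hn
  have hα' : α = 1 / (8 * n * (r.eval n : ℕ)) := by
    rw [hα]
    simp
  have hα0 : 0 ≤ α := by rw [hα']; positivity
  have hmα : ((m + 1 : ℕ) : ℝ) * α ≤ 1 / (8 * (r.eval n : ℕ)) := by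
    have h1 : ((m + 1 : ℕ) : ℝ) ≤ n := by exact_mod_cast hmn
    refine (mul_le_mul_of_nonneg_right h1 hα0).trans (le_of_eq ?_)
    rw [hα']
    field_simp
  have hr8' : 1 / (8 * ((r.eval n : ℕ) : ℝ)) = 1 / ((r.eval n : ℕ) : ℝ) / 8 := by
    field_simp
  have hrinv : 1 / ((r.eval n : ℕ) : ℝ) ≤ 1 := by
    rw [div_le_one (by linarith)]
    exact hr1
  have hrinv0 : 0 < 1 / ((r.eval n : ℕ) : ℝ) := by positivity
  have hδ : (0 : ℝ) < (2 : ℝ) ^ (-(c / 3 * n)) := by positivity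
  obtain ⟨U, U', hU, hmeas, hcirc, hUU'⟩ := exists_premeasurement (w := p.eval n) (m := m)
    (H.isHermitian n) (H.norm_eq_one n) hm hα0 (s := p.eval n) (fun k => by
      have hpi : Real.pi / 2 ≤ 2 := by linarith [Real.pi_le_four]
      refine hpn _ (by positivity) (le_trans ?_ hTm)
      rw [pow_succ]
      refine mul_le_mul ?_ hpi (by positivity) (by positivity)
      exact pow_le_pow_right₀ (by norm_num) (Nat.sub_le _ _)) (by linarith) hδ
  refine ⟨m, p.eval n, m - 1, ?_, U, U', hU, hmeas.mono ?_, hcirc.mono ?_, ?_⟩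
  · simp only [Polynomial.eval_add, Polynomial.eval_X]
    omega
  · have h1 : (2 : ℝ) ^ (c / 3 * n) ≤ 2 * (2 ^ (m + 1) * ((2 : ℝ) ^ (-(c / 3 * n))) ^ 2) := by
      have h2 : 2 * (2 ^ (m + 1) * ((2 : ℝ) ^ (-(c / 3 * n))) ^ 2) =
          (2 : ℝ) ^ (1 + ((m + 1 : ℕ) + -(c / 3 * n) * (2 : ℕ))) := by
        rw [Real.rpow_add (by norm_num), Real.rpow_add (by norm_num), Real.rpow_one,
          Real.rpow_natCast, Real.rpow_mul_natCast (by norm_num)]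
      rw [h2]
      refine Real.rpow_le_rpow_of_exponent_le (by norm_num) ?_
      push_cast at hmge ⊢
      linarith
    have hq1 : (1 : ℝ) ≤ (q.eval n : ℕ) := by exact_mod_cast one_le_eval hq0 hn
    have h3 : 36 / (2 ^ (m + 1) * ((2 : ℝ) ^ (-(c / 3 * n))) ^ 2) ≤ 1 / ((q.eval n : ℕ) : ℝ) := by
      rw [div_le_div_iff₀ (by positivity) (by linarith)]
      have h4 : (72 : ℝ) * (q.eval n : ℕ) ≤ (2 : ℝ) ^ (c / 3 * n) := by
        simpa using hqexp
      linarith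
    linarith
  · simp only [Polynomial.eval_add, Polynomial.eval_mul, Polynomial.eval_pow, Polynomial.eval_X,
      Polynomial.eval_ofNat]
    have h1 : 2 * (m + 1) ^ 2 ≤ 2 * n ^ 2 := by gcongr
    have h2 : 7 * (m + 1) * p.eval n ≤ 7 * n * p.eval n := by gcongr
    omega
  · linarith

/-- A measurement with accuracy `2^{-cn}` determines the phase `E t` up to `2^{-cn/2}` for all times
`t ≤ 2^{cn/2}`. -/
theorem mem_FFexp_of_mem_SEEMexp {H : HamiltonianFamily} (hH : H ∈ SEEMexp) : H ∈ FFexp := by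
  obtain ⟨δE, ⟨c, hc, hδ⟩, hmeas⟩ := hH
  refine ⟨fun n => (2 : ℝ) ^ (c / 2 * n), ⟨c / 2, by positivity,
    Eventually.of_forall fun n => le_rfl⟩, fun α hα => ?_⟩
  obtain ⟨q, hq0, hq⟩ := hα
  have hη : IsInvPoly fun n => 1 - (1 - 1 / (((32 * q ^ 2).eval n : ℕ) : ℝ)) := by
    simpa only [sub_sub_cancel] using
      isInvPoly_one_div_eval (mul_ne_zero (by norm_num) (pow_ne_zero 2 hq0))
  have hβ := isInvPoly_one_div_eval (mul_ne_zero (a := (4 : Polynomial ℕ)) (by norm_num) hq0)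
  obtain ⟨p, hp⟩ := hmeas _ _ hη hβ
  refine ⟨3 * p, ?_⟩
  filter_upwards [hp, hq, hδ, eventually_ge_atTop 1,
    eventually_eval_le_rpow (3 * q) (c := c / 2) (by positivity)] with n hpn hqn hδn hn hqexp
  intro t ht htT
  obtain ⟨m, w, f, hsize, U, U', hU, hUmeas, hcirc, hUU'⟩ := hpn
  -- The accuracy may be replaced by `2^{-cn}`, which is at least `δE n` and non-negative.
  have hUmeas' : IsPremeasurement (H.op n) f U
      (1 - 1 / (((32 * q ^ 2).eval n : ℕ) : ℝ)) ((2 : ℝ) ^ (-(c * n))) := by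
    intro ψ E hψ hE
    obtain ⟨a, g, hg, hUψ, ha⟩ := hUmeas ψ E hψ hE
    refine ⟨a, g, hg, hUψ, ha.trans (Finset.sum_le_sum_of_subset_of_nonneg ?_ fun x _ _ => by
      positivity)⟩
    intro x hx
    simp only [Finset.mem_filter, Finset.mem_univ, true_and] at hx ⊢
    exact hx.trans hδn
  obtain ⟨Z, hZ, hZerr⟩ := exists_fastForward (H.isHermitian n) hU hUmeas' hcirc hUU' ht
  have h3p : (3 * p).eval n = 3 * p.eval n := by simp
  refine ⟨m + 1 + w, by omega, Z, hZ.mono (by omega), fun ψ hψ => (hZerr ψ hψ).trans ?_⟩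
  have hq1 : (1 : ℝ) ≤ (q.eval n : ℕ) := by exact_mod_cast one_le_eval hq0 hn
  set Q : ℝ := ((q.eval n : ℕ) : ℝ) with hQ
  have h32 : (((32 * q ^ 2).eval n : ℕ) : ℝ) = 32 * Q ^ 2 := by simp [hQ]
  have h4 : (((4 * q).eval n : ℕ) : ℝ) = 4 * Q := by simp [hQ]
  have h3 : 3 * Q ≤ (2 : ℝ) ^ (c / 2 * n) := by simpa [hQ] using hqexp
  have hδt : (2 : ℝ) ^ (-(c * n)) * t ≤ 1 / (3 * Q) := by
    have h5 : (2 : ℝ) ^ (-(c * n)) * t ≤ (2 : ℝ) ^ (-(c * n)) * (2 : ℝ) ^ (c / 2 * n) :=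
      mul_le_mul_of_nonneg_left htT (by positivity)
    refine h5.trans ?_
    rw [← Real.rpow_add (by norm_num), show -(c * n) + c / 2 * n = -(c / 2 * n) by ring,
      Real.rpow_neg (by norm_num), one_div]
    exact inv_anti₀ (by positivity) h3
  have hδt0 : 0 ≤ (2 : ℝ) ^ (-(c * n)) * t := by positivity
  have hsq : ((2 : ℝ) ^ (-(c * n)) * t) ^ 2 ≤ (1 / (3 * Q)) ^ 2 := pow_le_pow_left₀ hδt0 hδt 2
  have hsqrt : Real.sqrt (((2 : ℝ) ^ (-(c * n)) * t) ^ 2 + 4 * (1 - (1 - 1 / (32 * Q ^ 2)))) ≤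
      1 / (2 * Q) := by
    refine (Real.sqrt_le_left (by positivity)).2 ?_
    have h6 : (1 / (3 * Q)) ^ 2 = 1 / Q ^ 2 * (1 / 9) := by field_simp; norm_num
    have h7 : 1 / (32 * Q ^ 2) = 1 / Q ^ 2 * (1 / 32) := by field_simp
    have h8 : (1 / (2 * Q)) ^ 2 = 1 / Q ^ 2 * (1 / 4) := by field_simp; norm_num
    have h9 : 0 ≤ 1 / Q ^ 2 := by positivity
    rw [h6] at hsq
    rw [h7, h8]
    linarith
  rw [h32, h4]
  refine le_trans (add_le_add_left hsqrt _) (le_trans (le_of_eq ?_) hqn)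
  field_simp
  norm_num

end Asymptotics

end FastForward

/-- The exponentially fast-forwardable normalized Hamiltonians are exactly those whose energy can
be measured efficiently with exponential accuracy. -/
theorem theorem4p1 : FastForward.FFexp = FastForward.SEEMexp :=
  Set.Subset.antisymm (fun _ => FastForward.mem_SEEMexp_of_mem_FFexp)
    fun _ => FastForward.mem_FFexp_of_mem_SEEMexp
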